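/- Let $\Omega\subset\mathbb{R}^3$ be a domain (nonempty, open, connected; not necessarily bounded) with Lipschitz boundary, i.e. near every boundary point $\Omega$ is, after a rigid motion, the region above the graph of a Lipschitz function. Let $\beta:(0,\infty)\to\mathbb{R}$ be strongly convex: there is $\kappa>0$ such that $$\beta(\lambda x_1+(1-\lambda)x_2)\le\lambda\beta(x_1)+(1-\lambda)\beta(x_2)-\kappa\lambda(1-\lambda)|x_1-x_2|^2\qquad\text{for all }x_1,x_2>0,\ 0\le\lambda\le1.$$ Let $f$ be a real-valued distribution on $\Omega$ such that $\operatorname{div}w=f$, in the sense of distributions on $\Omega$, for some bounded continuous vector field $w:\Omega\to\mathbb{R}^3$. Then there exist $v\in L^\infty(\Omega;\mathbb{R}^3)$ and $\rho\in L^\infty(\Omega;\mathbb{R})$, with $\rho\ge c$ almost everywhere in $\Omega$ for some constant $c>0$, such that $$\operatorname{div}(\rho v)=0,\qquad \operatorname{div}v=0,\qquad \operatorname{div}(\beta(\rho)v)=f\qquad\text{in }\Omega$$ in the sense of distributions, i.e. $\int_\Omega\rho v\cdot\nabla\psi\,dx=0$, $\int_\Omega v\cdot\nabla\psi\,dx=0$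 and $\int_\Omega\beta(\rho)v\cdot\nabla\psi\,dx=-\langle f,\psi\rangle$ for every $\psi\in C_c^\infty(\Omega)$, and such that $v\cdot n=0$ on $\partial\Omega$ in the weak sense that $$\int_\Omega v\cdot\nabla p\,dx=0\qquad\text{for every }p\in W^{1,1}(\Omega).$$ In particular, if $\Omega$ has finite measure (for instance if $\Omega$ is bounded), then $v$ belongs to the space $H(\Omega)=\{v\in L^2(\Omega;\mathbb{R}^3):\int_\Omega v\cdot\nabla p\,dx=0\text{ for every }p\in W^{1,2}(\Omega)\}$ of solenoidal vector fields. -/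

import Mathlib

open MeasureTheory Set TopologicalSpace
open scoped Distributions NNReal ENNReal

/-- Three-dimensional Euclidean space. -/
abbrev E3 : Type := EuclideanSpace ℝ (Fin 3)

/-- A (possibly unbounded) domain with Lipschitz boundary: a nonempty connected open set which,
near each of its boundary points and after a rigid motion, is the region above the graph of a
Lipschitz function of two variables. -/
def IsLipschitzDomain (Ω : Opens E3) : Prop :=
  IsConnected (Ω : Set E3) ∧
    ∀ x₀ ∈ frontier (Ω : Set E3),
      ∃ (A : E3 ≃ₗᵢ[ℝ] E3) (γ : EuclideanSpace ℝ (Fin 2) → ℝ) (L : ℝ≥0) (r : ℝ),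
        0 < r ∧ LipschitzWith L γ ∧
          ∀ x ∈ Metric.ball x₀ r,
            (x ∈ Ω ↔ γ !₂[A (x - x₀) 0, A (x - x₀) 1] < A (x - x₀) 2)

/-- `div u = f` on `Ω` in the sense of distributions, for a locally integrable vector field `u`:
`∫_Ω u · ∇ψ dx = - ⟨f, ψ⟩` for every test function `ψ`. -/
def IsDistribDiv (Ω : Opens E3) (u : E3 → E3) (f : 𝓓'(Ω, ℝ)) : Prop :=
  LocallyIntegrableOn u (Ω : Set E3) volume ∧
    ∀ ψ : 𝓓(Ω, ℝ), ∫ x in (Ω : Set E3), fderiv ℝ ψ x (u x) = - f ψ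

/-- `p` belongs to the Sobolev space `W^{1,q}(Ω)` and its weak gradient is `g`. -/
def IsSobolevWithGradient (Ω : Opens E3) (q : ℝ≥0∞) (p : E3 → ℝ) (g : E3 → E3) : Prop :=
  MemLp p q (volume.restrict (Ω : Set E3)) ∧
    MemLp g q (volume.restrict (Ω : Set E3)) ∧
      ∀ (ψ : 𝓓(Ω, ℝ)) (e : E3),
        ∫ x in (Ω : Set E3), p x * fderiv ℝ ψ x e = - ∫ x in (Ω : Set E3), inner ℝ (g x) e * ψ x

/-- The space `H(Ω)` of solenoidal vector fields: the fields `v ∈ L²(Ω; ℝ³)` with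
`∫_Ω v · ∇p dx = 0` for every `p ∈ W^{1,2}(Ω)`. -/
def solenoidalSpace (Ω : Opens E3) : Set (E3 → E3) :=
  {v | MemLp v 2 (volume.restrict (Ω : Set E3)) ∧
    ∀ (p : E3 → ℝ) (g : E3 → E3), IsSobolevWithGradient Ω 2 p g →
      ∫ x in (Ω : Set E3), inner ℝ (v x) (g x) = 0}

/-- For a bounded field `v` with `div v = 0`, the weak form of `v · n = 0` on `∂Ω`:
`∫_Ω v · ∇p dx = 0` for every `p ∈ W^{1,1}(Ω)`. The test functions need not vanish on `∂Ω`. As `v`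
is bounded and `∇p` is integrable, this makes sense also when `Ω` has infinite measure. -/
def HasZeroNormalTrace (Ω : Opens E3) (v : E3 → E3) : Prop :=
  ∀ (p : E3 → ℝ) (g : E3 → E3), IsSobolevWithGradient Ω 1 p g →
    ∫ x in (Ω : Set E3), inner ℝ (v x) (g x) = 0

/-!
Let `β` be evaluated at the three densities `1, 2, 3` only. If `u₀, u₁, u₂` are bounded fields of
which at most one is nonzero at almost every point, put `v = u₀ + u₁ + u₂` and let `ρ` be `1, 2, 3`
where `u₀, u₁, u₂` is nonzero. Then `b(ρ) v = b(1) u₀ + b(2) u₁ + b(3) u₂` for every function `b`, so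
that the three nonlinear equations become linear ones: it suffices that `uₘ - cₘ w` is orthogonal to
the gradients of all `p ∈ W^{1,1}(Ω)`, where `c = k (1, -2, 1)` and `k (β(1) - 2 β(2) + β(3)) = 1`.
The number `k` exists by strict convexity, and `∑ cₘ = ∑ (m + 1) cₘ = 0` makes `v` and `ρ v`
themselves orthogonal to gradients. This yields both the equations and the boundary condition; the
regularity of `∂Ω` plays no role, since `w` is changed only by fields with compact support in `Ω`.

The fields `uₘ` are built from `cₘ w` by convex integration (`exists_disjoint_fields`). Two constant
vectors `a, b` are the average of `(a / θ, 0)` and `(0, b / (1 - θ))`, with weights `θ` and `1 - θ`;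
for `θ = |a| / (|a| + |b|)` the sum of the norms is the same at both ends, which keeps all iterates
uniformly bounded. In dimension three there is a unit vector `ξ` orthogonal to both `a` and `b`, so a
fast oscillation between the ends in direction `ξ` is nearly divergence free, and is corrected by
taking it of the form `(∂_ξ h) a - (∂_a h) ξ` (`rotField`, `exists_rotField_near_wave`). The `defect`
of a triple is the sum of the pairwise minima of the norms. Splitting a pair whose minimum
is at least a third of the defect lowers the average defect by a fixed factor and moves the fields, in `L¹`, by at most a
multiple of the defect (`exists_perturbation_closedBall`). After localization to small balls, on which
continuous fields are almost constant (`exists_perturbation_step`), and iteration, the displacements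
are summable and the defects tend to zero, so the iterates converge almost everywhere to a triple
with zero defect.
-/

/-! ### Smooth square waves -/

/-- The `1`-periodic extension of a smooth function supported in `(0, 1)` is smooth. -/
theorem contDiff_comp_fract {G : ℝ → ℝ} (hG : ContDiff ℝ (⊤ : ℕ∞) G) {η : ℝ} (hη : 0 < η)
    (h0 : ∀ τ ≤ η, G τ = 0) (h1 : ∀ τ, 1 - η ≤ τ → G τ = 0) :
    ContDiff ℝ (⊤ : ℕ∞) (fun τ => G (Int.fract τ)) := by
  rw [contDiff_iff_contDiffAt]
  intro τ
  by_cases hτ : Int.fract τ = 0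
  · have hev : (fun τ => G (Int.fract τ)) =ᶠ[nhds τ] fun _ => (0 : ℝ) := by
      have hτ' : τ = ⌊τ⌋ := by
        have := Int.floor_add_fract τ
        rw [hτ] at this
        linarith
      filter_upwards [Metric.ball_mem_nhds τ hη] with s hs
      rw [Metric.mem_ball, Real.dist_eq, abs_lt] at hs
      by_cases hle : τ ≤ s
      · apply h0
        have h2 : (⌊τ⌋ : ℤ) ≤ ⌊s⌋ := Int.floor_le_floor hle
        have h3 : ((⌊τ⌋ : ℤ) : ℝ) ≤ ⌊s⌋ := by exact_mod_cast h2
        have := Int.floor_add_fract s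
        linarith
      · apply h1
        have h2 : ⌊s⌋ < ⌊τ⌋ := by
          rw [Int.floor_lt]
          linarith
        have h3 : ((⌊s⌋ : ℤ) : ℝ) + 1 ≤ ⌊τ⌋ := by exact_mod_cast h2
        have := Int.floor_add_fract s
        linarith
    exact contDiffAt_const.congr_of_eventuallyEq hev
  · have hev : (fun τ => G (Int.fract τ)) =ᶠ[nhds τ] fun s => G (s - ⌊τ⌋) := by
      have hl : (⌊τ⌋ : ℝ) < τ := by
        have := Int.floor_add_fract τ
        have := (Int.fract_nonneg τ).lt_of_ne' hτ
        linarith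
      filter_upwards [Ioo_mem_nhds hl (Int.lt_floor_add_one τ)] with s hs
      have : ⌊s⌋ = ⌊τ⌋ := Int.floor_eq_iff.2 ⟨hs.1.le, hs.2⟩
      rw [Int.fract, this]
    refine ContDiffAt.congr_of_eventuallyEq ?_ hev
    exact (hG.comp (contDiff_id.sub contDiff_const)).contDiffAt

/-- A smooth function supported in `(0, 1)` with prescribed integral `θ` and short transition between
the values `0` and `1`. It is a plateau with two flanks of width `η`; the position of the right flank
is found by the intermediate value theorem. -/
theorem exists_cutoff_integral_eq {θ ε : ℝ} (h0 : 0 < θ) (h1 : θ < 1) (hε : 0 < ε) :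
    ∃ (G : ℝ → ℝ) (η : ℝ), 0 < η ∧ ContDiff ℝ (⊤ : ℕ∞) G ∧ (∀ τ, 0 ≤ G τ ∧ G τ ≤ 1) ∧
      (∀ τ ≤ η, G τ = 0) ∧ (∀ τ, 1 - η ≤ τ → G τ = 0) ∧
      (∫ τ in (0 : ℝ)..1, G τ) = θ ∧ (∫ τ in (0 : ℝ)..1, G τ * (1 - G τ)) ≤ ε := by
  set η : ℝ := min (ε / 2) ((1 - θ) / 4) with hηdef
  have hη : 0 < η := lt_min (by linarith) (by linarith)
  have hηε : 2 * η ≤ ε := by linarith [min_le_left (ε / 2) ((1 - θ) / 4)]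
  have hηθ : 4 * η ≤ 1 - θ := by linarith [min_le_right (ε / 2) ((1 - θ) / 4)]
  let S := Real.smoothTransition
  let G : ℝ → ℝ → ℝ := fun l τ => S ((τ - η) / η) * S ((l - τ) / η)
  have hS0 : ∀ x, 0 ≤ S x := Real.smoothTransition.nonneg
  have hS1 : ∀ x, S x ≤ 1 := Real.smoothTransition.le_one
  have hSc : ContDiff ℝ (⊤ : ℕ∞) S := Real.smoothTransition.contDiff
  have hGs : ∀ l, ContDiff ℝ (⊤ : ℕ∞) (G l) := fun l =>
    (hSc.comp ((contDiff_id.sub contDiff_const).div_const _)).mul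
      (hSc.comp ((contDiff_const.sub contDiff_id).div_const _))
  have hG0 : ∀ l τ, 0 ≤ G l τ := fun l τ => mul_nonneg (hS0 _) (hS0 _)
  have hG1 : ∀ l τ, G l τ ≤ 1 := fun l τ => mul_le_one₀ (hS1 _) (hS0 _) (hS1 _)
  have hGc : Continuous (fun q : ℝ × ℝ => G q.1 q.2) :=
    (hSc.continuous.comp (by fun_prop)).mul (hSc.continuous.comp (by fun_prop))
  have hGle : ∀ l τ, τ ≤ η → G l τ = 0 := by
    intro l τ h
    have : S ((τ - η) / η) = 0 :=
      Real.smoothTransition.zero_of_nonpos (div_nonpos_of_nonpos_of_nonneg (by linarith) hη.le)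
    simp [G, this]
  have hGge : ∀ l τ, l ≤ τ → G l τ = 0 := by
    intro l τ h
    have : S ((l - τ) / η) = 0 :=
      Real.smoothTransition.zero_of_nonpos (div_nonpos_of_nonpos_of_nonneg (by linarith) hη.le)
    simp [G, this]
  have hGone : ∀ l τ, 2 * η ≤ τ → τ ≤ l - η → G l τ = 1 := by
    intro l τ h h'
    have e1 : S ((τ - η) / η) = 1 :=
      Real.smoothTransition.one_of_one_le (by rw [le_div_iff₀ hη]; linarith)
    have e2 : S ((l - τ) / η) = 1 :=
      Real.smoothTransition.one_of_one_le (by rw [le_div_iff₀ hη]; linarith)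
    simp [G, e1, e2]
  let m : ℝ → ℝ := fun l => ∫ τ in (0 : ℝ)..1, G l τ
  have hm : Continuous m :=
    intervalIntegral.continuous_parametric_intervalIntegral_of_continuous' hGc 0 1
  -- for `l = η` the flanks leave no room, for `l = 1 - η` the plateau fills almost the interval
  have hmη : m η = 0 := by
    have : ∀ τ, G η τ = 0 := fun τ => (le_total τ η).elim (hGle _ _) (hGge _ _)
    simp [m, this]
  have hi : ∀ l a b, IntervalIntegrable (G l) volume a b := fun l a b =>
    (hGs l).continuous.intervalIntegrable a b
  have hm1 : θ ≤ m (1 - η) := by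
    have hsplit : m (1 - η) = (∫ τ in (0 : ℝ)..(2 * η), G (1 - η) τ) +
        (∫ τ in (2 * η)..(1 - 2 * η), G (1 - η) τ) + ∫ τ in (1 - 2 * η)..1, G (1 - η) τ := by
      rw [intervalIntegral.integral_add_adjacent_intervals (hi _ _ _) (hi _ _ _),
        intervalIntegral.integral_add_adjacent_intervals (hi _ _ _) (hi _ _ _)]
    have e1 : 0 ≤ ∫ τ in (0 : ℝ)..(2 * η), G (1 - η) τ :=
      intervalIntegral.integral_nonneg (by linarith) fun τ _ => hG0 _ τ
    have e3 : 0 ≤ ∫ τ in (1 - 2 * η)..1, G (1 - η) τ :=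
      intervalIntegral.integral_nonneg (by linarith) fun τ _ => hG0 _ τ
    have e2 : (∫ τ in (2 * η)..(1 - 2 * η), G (1 - η) τ) =
        ∫ τ in (2 * η)..(1 - 2 * η), (1 : ℝ) := by
      apply intervalIntegral.integral_congr
      intro τ hτ
      rw [uIcc_of_le (by linarith)] at hτ
      exact hGone _ _ hτ.1 (by linarith [hτ.2])
    rw [e2, intervalIntegral.integral_const, smul_eq_mul] at hsplit
    linarith
  obtain ⟨l, hl, hlθ⟩ : θ ∈ m '' Icc η (1 - η) :=
    intermediate_value_Icc (by linarith) hm.continuousOn ⟨by rw [hmη]; exact h0.le, hm1⟩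
  refine ⟨G l, η, hη, hGs l, fun τ => ⟨hG0 l τ, hG1 l τ⟩, hGle l,
    fun τ h => hGge l τ (hl.2.trans h), hlθ, ?_⟩
  -- `G (1 - G)` is supported in the two transition intervals, each of length `η`
  let I1 := Icc η (2 * η)
  let I2 := Icc (l - η) l
  have hpt : ∀ τ, G l τ * (1 - G l τ) ≤ (I1 ∪ I2).indicator (fun _ => (1 : ℝ)) τ := by
    intro τ
    by_cases hτ : τ ∈ I1 ∪ I2
    · rw [indicator_of_mem hτ]
      nlinarith [hG0 l τ, hG1 l τ]
    · rw [indicator_of_notMem hτ]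
      have : G l τ = 0 ∨ G l τ = 1 := by
        by_cases a1 : τ ≤ η
        · exact Or.inl (hGle l τ a1)
        by_cases a2 : l ≤ τ
        · exact Or.inl (hGge l τ a2)
        right
        simp only [I1, I2, mem_union, mem_Icc, not_or, not_and, not_le] at hτ a1 a2
        refine hGone l τ (hτ.1 a1.le).le ?_
        by_contra hc
        linarith [hτ.2 (by linarith)]
      rcases this with h | h <;> simp [h]
  have hms : MeasurableSet (I1 ∪ I2) := measurableSet_Icc.union measurableSet_Icc
  have hfin : volume (I1 ∪ I2) < ⊤ :=
    (measure_union_le _ _).trans_lt (by simp [I1, I2])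
  rw [intervalIntegral.integral_of_le zero_le_one]
  have hgi : Integrable ((I1 ∪ I2).indicator (fun _ => (1 : ℝ))) volume :=
    (integrable_indicator_iff hms).2 (integrableOn_const hfin.ne)
  have hfi : IntegrableOn (fun τ => G l τ * (1 - G l τ)) (Ioc 0 1) volume := by
    have : Continuous (fun τ => G l τ * (1 - G l τ)) :=
      (hGs l).continuous.mul (continuous_const.sub (hGs l).continuous)
    exact (this.intervalIntegrable 0 1).1
  calc (∫ τ in Ioc (0 : ℝ) 1, G l τ * (1 - G l τ))
      ≤ ∫ τ in Ioc (0 : ℝ) 1, (I1 ∪ I2).indicator (fun _ => (1 : ℝ)) τ :=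
        integral_mono hfi hgi.integrableOn hpt
    _ ≤ ∫ τ, (I1 ∪ I2).indicator (fun _ => (1 : ℝ)) τ :=
        setIntegral_le_integral hgi (ae_of_all _ fun τ => indicator_nonneg (by simp) τ)
    _ = volume.real (I1 ∪ I2) := by rw [integral_indicator_const _ hms]; simp
    _ ≤ volume.real I1 + volume.real I2 := measureReal_union_le _ _
    _ = 2 * η := by
        simp only [I1, I2, Real.volume_real_Icc]
        rw [max_eq_left (by linarith), max_eq_left (by linarith)]
        ring
    _ ≤ ε := hηε

/-- A smoothed square wave of period `1` which takes the values `1` and `0` on proportions close to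
`θ` and `1 - θ`; its mean is exactly `θ`, so that `p - θ` has a bounded primitive `P`. -/
structure IsSquareWave (θ ε : ℝ) (p P : ℝ → ℝ) : Prop where
  contDiff_primitive : ContDiff ℝ (⊤ : ℕ∞) P
  hasDerivAt : ∀ τ, HasDerivAt P (p τ - θ) τ
  bounded : ∃ C, ∀ τ, |P τ| ≤ C
  continuous : Continuous p
  periodic : Function.Periodic p 1
  nonneg : ∀ τ, 0 ≤ p τ
  le_one : ∀ τ, p τ ≤ 1
  integral_eq : ∫ τ in (0 : ℝ)..1, p τ = θ
  integral_transition_le : ∫ τ in (0 : ℝ)..1, p τ * (1 - p τ) ≤ ε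

theorem exists_isSquareWave {θ ε : ℝ} (h0 : 0 < θ) (h1 : θ < 1) (hε : 0 < ε) :
    ∃ p P : ℝ → ℝ, IsSquareWave θ ε p P := by
  obtain ⟨G, η, hη, hGs, hG, hGl, hGr, hGi, hGt⟩ := exists_cutoff_integral_eq h0 h1 hε
  let p : ℝ → ℝ := fun τ => G (Int.fract τ)
  have hps : ContDiff ℝ (⊤ : ℕ∞) p := contDiff_comp_fract hGs hη hGl hGr
  have hpG : ∀ τ ∈ Icc (0 : ℝ) 1, p τ = G τ := by
    intro τ hτ
    rcases hτ.2.lt_or_eq with h | h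
    · simp only [p]
      rw [Int.fract_eq_self.2 ⟨hτ.1, h⟩]
    · simp only [p, h, Int.fract_one]
      rw [hGl 0 hη.le, hGr 1 (by linarith)]
  have hper : Function.Periodic p 1 := fun τ => by simp [p]
  have hint : ∫ τ in (0 : ℝ)..1, p τ = θ := by
    rw [← hGi]
    apply intervalIntegral.integral_congr
    intro τ hτ
    rw [uIcc_of_le zero_le_one] at hτ
    exact hpG τ hτ
  let P : ℝ → ℝ := fun s => ∫ τ in (0 : ℝ)..s, (p τ - θ)
  have hc : Continuous (fun τ => p τ - θ) := hps.continuous.sub continuous_const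
  have hd : ∀ τ, HasDerivAt P (p τ - θ) τ := fun τ =>
    intervalIntegral.integral_hasDerivAt_right (hc.intervalIntegrable _ _)
      (hc.stronglyMeasurableAtFilter _ _) hc.continuousAt
  have hPs : ContDiff ℝ (⊤ : ℕ∞) P := by
    rw [contDiff_infty_iff_deriv]
    refine ⟨fun τ => (hd τ).differentiableAt, ?_⟩
    have : deriv P = fun τ => p τ - θ := funext fun τ => (hd τ).deriv
    rw [this]
    exact hps.sub contDiff_const
  have hPper : Function.Periodic P 1 := by
    intro s
    have hper' : Function.Periodic (fun τ => p τ - θ) 1 := fun τ => by simp [hper τ]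
    have e : P (s + 1) = P s + ∫ τ in s..(s + 1), (p τ - θ) :=
      (intervalIntegral.integral_add_adjacent_intervals (hc.intervalIntegrable _ _)
        (hc.intervalIntegrable _ _)).symm
    rw [e, hper'.intervalIntegral_add_eq s 0, zero_add,
      intervalIntegral.integral_sub (hps.continuous.intervalIntegrable _ _) (by simp), hint]
    simp
  have hb : ∃ C, ∀ τ, |P τ| ≤ C := by
    obtain ⟨C, hC⟩ := isCompact_Icc.exists_bound_of_continuousOn (s := Icc (0 : ℝ) 1)
      hPs.continuous.continuousOn
    refine ⟨C, fun τ => ?_⟩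
    obtain ⟨y, hy, hyy⟩ := hPper.exists_mem_Ico₀ zero_lt_one τ
    rw [hyy]
    exact hC y ⟨hy.1, hy.2.le⟩
  refine ⟨p, P, hPs, hd, hb, hps.continuous, hper, fun τ => (hG _).1, fun τ => (hG _).2, hint, ?_⟩
  refine le_of_eq_of_le ?_ hGt
  apply intervalIntegral.integral_congr
  intro τ hτ
  rw [uIcc_of_le zero_le_one] at hτ
  simp only [hpG τ hτ]

/-- Averaging over the phase: some translate of a periodic function has, along `φ`, at most its
mean value. As `μ` is arbitrary, this replaces the weak convergence of fast oscillations. -/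
theorem exists_phase_integral_le {X : Type*} [TopologicalSpace X] [MeasurableSpace X]
    [BorelSpace X] [SecondCountableTopology X]
    (μ : Measure X) [IsFiniteMeasure μ] {k : ℝ → ℝ}
    (hk : Continuous k) (hper : Function.Periodic k 1) {φ : X → ℝ} (hφ : Continuous φ) :
    ∃ t : ℝ, ∫ x, k (φ x + t) ∂μ ≤ μ.real univ * ∫ τ in (0 : ℝ)..1, k τ := by
  obtain ⟨C, hC⟩ : ∃ C, ∀ τ, ‖k τ‖ ≤ C := by
    obtain ⟨C, hC⟩ := isCompact_Icc.exists_bound_of_continuousOn (s := Icc (0 : ℝ) 1)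
      hk.continuousOn
    refine ⟨C, fun τ => ?_⟩
    obtain ⟨y, hy, hyy⟩ := hper.exists_mem_Ico₀ zero_lt_one τ
    rw [hyy]
    exact hC y ⟨hy.1, hy.2.le⟩
  let ν : Measure ℝ := volume.restrict (Ioc 0 1)
  have : IsProbabilityMeasure ν := ⟨by simp [ν]⟩
  have hjoint : Integrable (Function.uncurry fun (t : ℝ) (x : X) => k (φ x + t)) (ν.prod μ) := by
    have hcont : Continuous (Function.uncurry fun (t : ℝ) (x : X) => k (φ x + t)) :=
      hk.comp ((hφ.comp continuous_snd).add continuous_fst)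
    exact Integrable.of_bound hcont.aestronglyMeasurable C (ae_of_all _ fun _ => hC _)
  have hswap := integral_integral_swap hjoint
  have hinner : ∀ x, ∫ t, k (φ x + t) ∂ν = ∫ τ in (0 : ℝ)..1, k τ := by
    intro x
    have : ∫ t, k (φ x + t) ∂ν = ∫ t in (0 : ℝ)..1, k (φ x + t) := by
      rw [intervalIntegral.integral_of_le zero_le_one]
    rw [this, intervalIntegral.integral_comp_add_left (fun s => k s), add_zero,
      hper.intervalIntegral_add_eq (φ x) 0, zero_add]
  simp only [hinner, integral_const, smul_eq_mul] at hswap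
  obtain ⟨t, ht⟩ := exists_le_integral hjoint.integral_prod_left
  exact ⟨t, ht.trans hswap.le⟩

/-! ### Fields orthogonal to gradients -/

theorem integrable_inner_of_memLp_top {μ : Measure E3} {v g : E3 → E3}
    (hv : MemLp v ∞ μ) (hg : MemLp g 1 μ) : Integrable (fun x => inner ℝ (v x) (g x)) μ := by
  obtain ⟨C, hC⟩ := eLpNormEssSup_lt_top_iff_isBoundedUnder.1
    (eLpNorm_exponent_top (f := v) (μ := μ) ▸ hv.2)
  refine ((memLp_one_iff_integrable.1 hg).norm.const_mul (C : ℝ)).mono'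
    (hv.1.inner hg.1) ?_
  filter_upwards [Filter.eventually_map.1 hC] with x hx
  have hx' : ‖v x‖ ≤ C := by exact_mod_cast hx
  exact (norm_inner_le_norm _ _).trans (by gcongr)

theorem HasZeroNormalTrace.sum {Ω : Opens E3} {ι : Type*} {s : Finset ι} {v : ι → E3 → E3}
    {c : ι → ℝ} (hm : ∀ i ∈ s, MemLp (v i) ∞ (volume.restrict (Ω : Set E3)))
    (hv : ∀ i ∈ s, HasZeroNormalTrace Ω (v i)) :
    HasZeroNormalTrace Ω (fun x => ∑ i ∈ s, c i • v i x) := by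
  intro p g hpg
  simp only [sum_inner, real_inner_smul_left]
  rw [integral_finsetSum _ fun i hi =>
    (integrable_inner_of_memLp_top (hm i hi) hpg.2.1).const_mul (c i)]
  refine Finset.sum_eq_zero fun i hi => ?_
  rw [integral_const_mul, hv i hi p g hpg, mul_zero]

theorem HasZeroNormalTrace.add {Ω : Opens E3} {u v : E3 → E3}
    (hum : MemLp u ∞ (volume.restrict (Ω : Set E3)))
    (hvm : MemLp v ∞ (volume.restrict (Ω : Set E3)))
    (hu : HasZeroNormalTrace Ω u) (hv : HasZeroNormalTrace Ω v) :
    HasZeroNormalTrace Ω (fun x => u x + v x) := by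
  intro p g hpg
  simp only [inner_add_left]
  rw [integral_add (integrable_inner_of_memLp_top hum hpg.2.1)
    (integrable_inner_of_memLp_top hvm hpg.2.1), hu p g hpg, hv p g hpg, add_zero]

theorem HasZeroNormalTrace.congr_ae {Ω : Opens E3} {u v : E3 → E3}
    (hu : HasZeroNormalTrace Ω u) (h : u =ᵐ[volume.restrict (Ω : Set E3)] v) :
    HasZeroNormalTrace Ω v := by
  intro p g hpg
  rw [← hu p g hpg]
  apply integral_congr_ae
  filter_upwards [h] with x hx
  rw [hx]

theorem HasZeroNormalTrace.of_tendsto {Ω : Opens E3} {u : ℕ → E3 → E3} {v : E3 → E3} {C : ℝ}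
    (hum : ∀ n, AEStronglyMeasurable (u n) (volume.restrict (Ω : Set E3)))
    (hb : ∀ n, ∀ᵐ x ∂volume.restrict (Ω : Set E3), ‖u n x‖ ≤ C)
    (hu : ∀ n, HasZeroNormalTrace Ω (u n))
    (h : ∀ᵐ x ∂volume.restrict (Ω : Set E3),
      Filter.Tendsto (fun n => u n x) Filter.atTop (nhds (v x))) :
    HasZeroNormalTrace Ω v := by
  intro p g hpg
  have hlim := tendsto_integral_of_dominated_convergence (μ := volume.restrict (Ω : Set E3))
    (F := fun n x => inner ℝ (u n x) (g x)) (f := fun x => inner ℝ (v x) (g x))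
    (fun x => C * ‖g x‖) (fun n => (hum n).inner hpg.2.1.1)
    ((memLp_one_iff_integrable.1 hpg.2.1).norm.const_mul C)
    (fun n => by
      filter_upwards [hb n] with x hx
      exact (norm_inner_le_norm _ _).trans (by gcongr))
    (by
      filter_upwards [h] with x hx
      exact hx.inner tendsto_const_nhds)
  simp only [hu _ p g hpg] at hlim
  exact tendsto_nhds_unique tendsto_const_nhds hlim |>.symm

theorem isSobolevWithGradient_testFunction {Ω : Opens E3} (ψ : 𝓓(Ω, ℝ)) :
    IsSobolevWithGradient Ω 1 ψ (gradient ψ) := by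
  have hgc : Continuous (fderiv ℝ ψ) := ψ.contDiff.continuous_fderiv (by simp)
  have hgr : Continuous (gradient ψ) := (InnerProductSpace.toDual ℝ E3).symm.continuous.comp hgc
  have hgs : HasCompactSupport (gradient ψ) := by
    refine (ψ.hasCompactSupport.fderiv ℝ).comp_left (g := (InnerProductSpace.toDual ℝ E3).symm) ?_
    simp
  refine ⟨(ψ.continuous.memLp_of_hasCompactSupport ψ.hasCompactSupport).restrict _,
    (hgr.memLp_of_hasCompactSupport hgs).restrict _, fun φ e => ?_⟩
  have hφc : Continuous (fun x => fderiv ℝ φ x e) :=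
    (φ.contDiff.continuous_fderiv (by simp)).clm_apply continuous_const
  have hψc : Continuous (fun x => fderiv ℝ ψ x e) := hgc.clm_apply continuous_const
  have hin : ∀ x, inner ℝ (gradient ψ x) e = fderiv ℝ ψ x e := fun x => by
    simp [gradient]
  simp only [hin]
  rw [setIntegral_eq_integral_of_forall_compl_eq_zero,
    setIntegral_eq_integral_of_forall_compl_eq_zero]
  · apply integral_mul_fderiv_eq_neg_fderiv_mul_of_integrable
    · exact (hψc.mul φ.continuous).integrable_of_hasCompactSupport φ.hasCompactSupport.mul_left
    · exact (ψ.continuous.mul hφc).integrable_of_hasCompactSupport ψ.hasCompactSupport.mul_right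
    · exact (ψ.continuous.mul φ.continuous).integrable_of_hasCompactSupport
        ψ.hasCompactSupport.mul_right
    · exact fun x _ => ψ.contDiff.differentiable (by simp) x
    · exact fun x _ => φ.contDiff.differentiable (by simp) x
  · intro x hx
    rw [image_eq_zero_of_notMem_tsupport fun h => hx (φ.tsupport_subset h), mul_zero]
  · intro x hx
    rw [image_eq_zero_of_notMem_tsupport fun h => hx (ψ.tsupport_subset h), zero_mul]

theorem locallyIntegrableOn_of_memLp_top {Ω : Opens E3} {v : E3 → E3}
    (hv : MemLp v ∞ (volume.restrict (Ω : Set E3))) :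
    LocallyIntegrableOn v (Ω : Set E3) volume := by
  have h : LocallyIntegrable v (volume.restrict (Ω : Set E3)) := hv.locallyIntegrable le_top
  exact locallyIntegrableOn_of_locallyIntegrable_restrict h

/-- Test functions belong to `W^{1,1}`, so a vanishing normal trace contains solenoidality. -/
theorem HasZeroNormalTrace.integral_fderiv_eq_zero {Ω : Opens E3} {v : E3 → E3}
    (hv : HasZeroNormalTrace Ω v) (ψ : 𝓓(Ω, ℝ)) :
    ∫ x in (Ω : Set E3), fderiv ℝ ψ x (v x) = 0 := by
  rw [← hv ψ _ (isSobolevWithGradient_testFunction ψ)]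
  refine integral_congr_ae (ae_of_all _ fun x => ?_)
  simp only
  rw [real_inner_comm]
  simp [gradient]

theorem HasZeroNormalTrace.isDistribDiv_zero {Ω : Opens E3} {v : E3 → E3}
    (hm : MemLp v ∞ (volume.restrict (Ω : Set E3))) (hv : HasZeroNormalTrace Ω v) :
    IsDistribDiv Ω v 0 :=
  ⟨locallyIntegrableOn_of_memLp_top hm, fun ψ => by
    rw [hv.integral_fderiv_eq_zero ψ]; simp⟩

/-- The field `(∂_ξ h) a - (∂_a h) ξ`. It is divergence free because second derivatives of `h`
commute; in three dimensions it is the curl of `h (a × ξ)`. -/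
noncomputable def rotField (h : E3 → ℝ) (ξ a : E3) (x : E3) : E3 :=
  fderiv ℝ h x ξ • a - fderiv ℝ h x a • ξ

theorem continuous_rotField {h : E3 → ℝ} (hh : ContDiff ℝ (⊤ : ℕ∞) h) (ξ a : E3) :
    Continuous (rotField h ξ a) := by
  have := hh.continuous_fderiv (by simp)
  unfold rotField
  fun_prop

theorem rotField_eq_zero {h : E3 → ℝ} {x : E3} (hx : x ∉ tsupport h) (ξ a : E3) :
    rotField h ξ a x = 0 := by
  have : fderiv ℝ h x = 0 := by
    by_contra hne
    exact hx (support_fderiv_subset ℝ hne)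
  simp [rotField, this]

/-- Compactly supported fields `rotField h ξ a` are orthogonal to all gradients: integrate by parts
against the test functions `∂_ξ h` and `∂_a h`. -/
theorem hasZeroNormalTrace_rotField {Ω : Opens E3} {h : E3 → ℝ} (hh : ContDiff ℝ (⊤ : ℕ∞) h)
    (hc : HasCompactSupport h) (hs : tsupport h ⊆ Ω) (ξ a : E3) :
    HasZeroNormalTrace Ω (rotField h ξ a) := by
  intro p g hpg
  have hd : ContDiff ℝ (⊤ : ℕ∞) (fderiv ℝ h) := hh.fderiv_right (by simp)
  let D : E3 → 𝓓(Ω, ℝ) := fun e =>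
    ⟨fun x => fderiv ℝ h x e, hd.clm_apply contDiff_const, hc.fderiv_apply ℝ e,
      (tsupport_fderiv_apply_subset ℝ e).trans hs⟩
  have hDv : ∀ e x, D e x = fderiv ℝ h x e := fun e x => rfl
  have hi : ∀ e e', Integrable (fun x => inner ℝ (g x) e' * D e x)
      (volume.restrict (Ω : Set E3)) := by
    intro e e'
    obtain ⟨C, hC⟩ := (D e).continuous.bounded_above_of_compact_support (D e).hasCompactSupport
    exact ((memLp_one_iff_integrable.1 hpg.2.1).inner_const e').mul_bdd (c := C)
      (D e).continuous.aestronglyMeasurable (ae_of_all _ hC)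
  have hsecond : ∀ e e' x, fderiv ℝ (D e) x e' = fderiv ℝ (fderiv ℝ h) x e' e := by
    intro e e' x
    have hdx : DifferentiableAt ℝ (fderiv ℝ h) x := hd.differentiable (by simp) x
    change fderiv ℝ (fun y => fderiv ℝ h y e) x e' = _
    rw [fderiv_clm_apply hdx (differentiableAt_const e)]
    simp
  have hsymm : ∀ x, fderiv ℝ (D ξ) x a = fderiv ℝ (D a) x ξ := by
    intro x
    rw [hsecond, hsecond]
    exact (hh.contDiffAt.isSymmSndFDerivAt
      (by simpa using WithTop.coe_le_coe.2 (le_top : (2 : ℕ∞) ≤ ⊤))).eq a ξ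
  have h1 := hpg.2.2 (D ξ) a
  have h2 := hpg.2.2 (D a) ξ
  simp only [hsymm] at h1
  have e : (fun x => inner ℝ (rotField h ξ a x) (g x)) =
      fun x => inner ℝ (g x) a * D ξ x - inner ℝ (g x) ξ * D a x := by
    funext x
    rw [rotField, inner_sub_left, real_inner_smul_left, real_inner_smul_left, hDv, hDv,
      real_inner_comm a, real_inner_comm ξ]
    ring
  rw [e, integral_sub (hi _ _) (hi _ _)]
  linarith

/-! ### Splitting a pair of vectors -/

/-- The sum of the pairwise minima of the norms. It vanishes exactly when at most one of the three
vectors is nonzero. -/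
noncomputable def defect (z : Fin 3 → E3) : ℝ :=
  min ‖z 0‖ ‖z 1‖ + min ‖z 0‖ ‖z 2‖ + min ‖z 1‖ ‖z 2‖

theorem defect_eq (z : Fin 3 → E3) {i j k : Fin 3} (hij : i ≠ j) (hik : i ≠ k) (hjk : j ≠ k) :
    defect z = min ‖z i‖ ‖z j‖ + min ‖z i‖ ‖z k‖ + min ‖z j‖ ‖z k‖ := by
  unfold defect
  have h01 := min_comm ‖z 0‖ ‖z 1‖
  have h02 := min_comm ‖z 0‖ ‖z 2‖
  have h12 := min_comm ‖z 1‖ ‖z 2‖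
  fin_cases i <;> fin_cases j <;> fin_cases k <;>
    first
      | exact absurd rfl hij
      | exact absurd rfl hik
      | exact absurd rfl hjk
      | (simp <;> linarith)

theorem sum_eq_of_distinct (f : Fin 3 → ℝ) {i j k : Fin 3} (hij : i ≠ j) (hik : i ≠ k)
    (hjk : j ≠ k) : ∑ m, f m = f i + f j + f k := by
  have : (Finset.univ : Finset (Fin 3)) = {i, j, k} := by
    revert i j k; decide
  rw [this, Finset.sum_insert (by simp [hij, hik]), Finset.sum_insert (by simp [hjk]),
    Finset.sum_singleton]
  ring

theorem defect_nonneg (z : Fin 3 → E3) : 0 ≤ defect z := by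
  unfold defect
  positivity

theorem defect_le_sum_norm (z : Fin 3 → E3) : defect z ≤ ∑ m, ‖z m‖ := by
  have h : ∀ a b : ℝ, min a b ≤ (a + b) / 2 := fun a b => by
    linarith [min_le_left a b, min_le_right a b]
  rw [Fin.sum_univ_three]
  unfold defect
  linarith [h ‖z 0‖ ‖z 1‖, h ‖z 0‖ ‖z 2‖, h ‖z 1‖ ‖z 2‖]

/-- The defect is Lipschitz: each of the three norms enters in two of the minima. -/
theorem defect_le_add (y z : Fin 3 → E3) : defect y ≤ defect z + 2 * ∑ m, ‖y m - z m‖ := by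
  have h : ∀ i j, min ‖y i‖ ‖y j‖ ≤ min ‖z i‖ ‖z j‖ + (‖y i - z i‖ + ‖y j - z j‖) := by
    intro i j
    have hi := norm_le_norm_add_norm_sub' (y i) (z i)
    have hj := norm_le_norm_add_norm_sub' (y j) (z j)
    rw [← min_add_add_right]
    exact min_le_min (by linarith [norm_nonneg (y j - z j)])
      (by linarith [norm_nonneg (y i - z i)])
  rw [Fin.sum_univ_three]
  unfold defect
  linarith [h 0 1, h 0 2, h 1 2]

theorem continuous_defect : Continuous defect := by
  unfold defect
  fun_prop

theorem exists_pair_defect_le (z : Fin 3 → E3) :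
    ∃ i j k : Fin 3, i ≠ j ∧ i ≠ k ∧ j ≠ k ∧ defect z ≤ 3 * min ‖z i‖ ‖z j‖ := by
  by_contra! h
  have h1 := h 0 1 2 (by decide) (by decide) (by decide)
  have h2 := h 0 2 1 (by decide) (by decide) (by decide)
  have h3 := h 1 2 0 (by decide) (by decide) (by decide)
  unfold defect at h1 h2 h3
  linarith

/-- The direction in which the pair `(z i, z j)` is split: with `θ = ‖z i‖ / (‖z i‖ + ‖z j‖)`, the
two ends `z + (1 - θ) d` and `z - θ d` of the segment have vanishing `j`-th and `i`-th entry,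
respectively, and on the segment `‖z i‖ + ‖z j‖` is constant. -/
noncomputable def splitDir (z : Fin 3 → E3) (i j : Fin 3) (m : Fin 3) : E3 :=
  if m = i then ((‖z i‖ + ‖z j‖) / ‖z i‖) • z i
  else if m = j then -(((‖z i‖ + ‖z j‖) / ‖z j‖) • z j) else 0

section Split

variable {z : Fin 3 → E3} {i j k : Fin 3}

theorem norm_split_left (hi : 0 < ‖z i‖) (hj : 0 < ‖z j‖) {q : ℝ} (hq0 : 0 ≤ q) :
    ‖z i + (q - ‖z i‖ / (‖z i‖ + ‖z j‖)) • splitDir z i j i‖ = q * (‖z i‖ + ‖z j‖) := by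
  have e : z i + (q - ‖z i‖ / (‖z i‖ + ‖z j‖)) • splitDir z i j i =
      (q * (‖z i‖ + ‖z j‖) / ‖z i‖) • z i := by
    rw [splitDir, if_pos rfl, smul_smul]
    nth_rewrite 1 [← one_smul ℝ (z i)]
    rw [← add_smul]
    congr 1
    field_simp
    ring
  rw [e, norm_smul, Real.norm_of_nonneg (by positivity)]
  field_simp

theorem norm_split_right (hij : i ≠ j) (hi : 0 < ‖z i‖) (hj : 0 < ‖z j‖) {q : ℝ} (hq1 : q ≤ 1) :
    ‖z j + (q - ‖z i‖ / (‖z i‖ + ‖z j‖)) • splitDir z i j j‖ = (1 - q) * (‖z i‖ + ‖z j‖) := by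
  have e : z j + (q - ‖z i‖ / (‖z i‖ + ‖z j‖)) • splitDir z i j j =
      ((1 - q) * (‖z i‖ + ‖z j‖) / ‖z j‖) • z j := by
    rw [splitDir, if_neg hij.symm, if_pos rfl, smul_neg, smul_smul, ← neg_smul]
    nth_rewrite 1 [← one_smul ℝ (z j)]
    rw [← add_smul]
    congr 1
    field_simp
    ring
  have : 0 ≤ 1 - q := by linarith
  rw [e, norm_smul, Real.norm_of_nonneg (by positivity)]
  field_simp

theorem splitDir_other (hik : i ≠ k) (hjk : j ≠ k) : splitDir z i j k = 0 := by
  rw [splitDir, if_neg hik.symm, if_neg hjk.symm]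

theorem sum_norm_splitDir (hij : i ≠ j) (hik : i ≠ k) (hjk : j ≠ k)
    (hi : 0 < ‖z i‖) (hj : 0 < ‖z j‖) :
    ∑ m, ‖splitDir z i j m‖ = 2 * (‖z i‖ + ‖z j‖) := by
  rw [sum_eq_of_distinct _ hij hik hjk, splitDir_other hik hjk, norm_zero, splitDir, splitDir,
    if_pos rfl, if_neg hij.symm, if_pos rfl, norm_neg, norm_smul, norm_smul,
    Real.norm_of_nonneg (by positivity), Real.norm_of_nonneg (by positivity)]
  field_simp
  ring

theorem sum_norm_split (hij : i ≠ j) (hik : i ≠ k) (hjk : j ≠ k)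
    (hi : 0 < ‖z i‖) (hj : 0 < ‖z j‖) {q : ℝ} (hq0 : 0 ≤ q) (hq1 : q ≤ 1) :
    ∑ m, ‖z m + (q - ‖z i‖ / (‖z i‖ + ‖z j‖)) • splitDir z i j m‖ = ∑ m, ‖z m‖ := by
  rw [sum_eq_of_distinct _ hij hik hjk, sum_eq_of_distinct _ hij hik hjk,
    norm_split_left hi hj hq0, norm_split_right hij hi hj hq1, splitDir_other hik hjk, smul_zero,
    add_zero]
  ring

/-- Along the splitting segment the defect is, up to a term which vanishes at both ends, at most
what the third entry contributes at the ends. -/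
theorem defect_split_le (hij : i ≠ j) (hik : i ≠ k) (hjk : j ≠ k)
    (hi : 0 < ‖z i‖) (hj : 0 < ‖z j‖) {q : ℝ} (hq0 : 0 ≤ q) (hq1 : q ≤ 1) :
    defect (fun m => z m + (q - ‖z i‖ / (‖z i‖ + ‖z j‖)) • splitDir z i j m) ≤
      min ‖z i‖ ‖z k‖ + min ‖z j‖ ‖z k‖ + 6 * (‖z i‖ + ‖z j‖) * (q * (1 - q)) := by
  rw [defect_eq _ hij hik hjk, norm_split_left hi hj hq0, norm_split_right hij hi hj hq1,
    splitDir_other hik hjk, smul_zero, add_zero]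
  have hc := norm_nonneg (z k)
  set A := ‖z i‖
  set B := ‖z j‖
  set c := ‖z k‖
  set N := A + B with hN
  have hN0 : 0 < N := by linarith
  have hmin : ∀ s : ℝ, 0 ≤ s → s ≤ 1 → min s (1 - s) ≤ 2 * (s * (1 - s)) := by
    intro s h0 h1
    rcases le_total s (1 - s) with h | h
    · rw [min_eq_left h]; nlinarith
    · rw [min_eq_right h]; nlinarith
  -- `s ↦ min (s N) c` lies above its chord by at most `N min s (1 - s)`
  have hex : ∀ s : ℝ, 0 ≤ s → s ≤ 1 → min (s * N) c ≤ s * min N c + 2 * N * (s * (1 - s)) := by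
    intro s h0 h1
    rcases le_total N c with h | h
    · rw [min_eq_left h]
      have : 0 ≤ 2 * N * (s * (1 - s)) := by
        have := sub_nonneg.2 h1
        positivity
      linarith [min_le_left (s * N) c]
    · rw [min_eq_right h]
      have e1 : min (s * N) c - s * c ≤ N * min s (1 - s) := by
        rw [mul_min_of_nonneg _ _ hN0.le]
        apply le_min
        · nlinarith [min_le_left (s * N) c]
        · nlinarith [min_le_right (s * N) c]
      nlinarith [hmin s h0 h1]
  have h1 : min (q * N) ((1 - q) * N) ≤ 2 * N * (q * (1 - q)) := by
    rw [← min_mul_of_nonneg _ _ hN0.le]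
    nlinarith [hmin q hq0 hq1]
  have h2 := hex q hq0 hq1
  have h3 := hex (1 - q) (by linarith) (by linarith)
  have h4 : min N c ≤ min A c + min B c := by
    rcases le_total A c with h | h
    · rcases le_total B c with h' | h'
      · rw [min_eq_left h, min_eq_left h']; exact min_le_left _ _
      · rw [min_eq_left h, min_eq_right h']; linarith [min_le_right N c]
    · rw [min_eq_right h]; linarith [min_le_right N c, le_min hj.le hc]
  nlinarith

end Split

/-- Two vectors of three-dimensional space have a common normal. This is where the dimension enters:
the two fields of a pair can oscillate in the same direction `ξ`. -/
theorem exists_unit_orthogonal (a b : E3) :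
    ∃ ξ : E3, ‖ξ‖ = 1 ∧ inner ℝ ξ a = 0 ∧ inner ℝ ξ b = 0 := by
  let K : Submodule ℝ E3 := Submodule.span ℝ {a, b}
  have hK : K ≠ ⊤ := by
    intro h
    have h1 : Module.finrank ℝ K ≤ 2 := by
      classical
      have := finrank_span_finset_le_card (R := ℝ) ({a, b} : Finset E3)
      rw [Finset.coe_pair] at this
      exact this.trans Finset.card_le_two
    rw [h, finrank_top, finrank_euclideanSpace_fin] at h1
    omega
  have hK' : Kᗮ ≠ ⊥ := fun h => hK (Submodule.orthogonal_eq_bot_iff.1 h)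
  obtain ⟨v, hv, hv0⟩ := Submodule.exists_mem_ne_zero_of_ne_bot hK'
  rw [Submodule.mem_orthogonal'] at hv
  refine ⟨‖v‖⁻¹ • v, norm_smul_inv_norm hv0, ?_, ?_⟩
  · rw [real_inner_smul_left, hv a (Submodule.subset_span (by simp)), mul_zero]
  · rw [real_inner_smul_left, hv b (Submodule.subset_span (by simp)), mul_zero]

/-- A divergence-free field with compact support close to a laminate: with
`h = χ P(Λ ⟨ξ, ·⟩ + t) / Λ`, the field `rotField h ξ a` is `χ (p(Λ ⟨ξ, ·⟩ + t) - θ) a` up to terms of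
order `1 / Λ`, for all phases `t` and all `a` orthogonal to the direction `ξ` of oscillation. -/
theorem exists_rotField_near_wave {θ η : ℝ} {p P : ℝ → ℝ} (hw : IsSquareWave θ η p P)
    {ξ : E3} (hξ : ‖ξ‖ = 1) (x₀ : E3) {r' r : ℝ} (hr' : 0 < r') (hr : r' < r) {δ : ℝ}
    (hδ : 0 < δ) :
    ∃ (Λ : ℝ) (χ : E3 → ℝ), (∀ x, 0 ≤ χ x ∧ χ x ≤ 1) ∧ (∀ x ∈ Metric.closedBall x₀ r', χ x = 1) ∧
      ∀ t : ℝ, ∃ h : E3 → ℝ, ContDiff ℝ (⊤ : ℕ∞) h ∧ tsupport h ⊆ Metric.closedBall x₀ r ∧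
        ∀ (a : E3), inner ℝ ξ a = 0 → ∀ x,
          ‖rotField h ξ a x - (χ x * (p (Λ * inner ℝ ξ x + t) - θ)) • a‖ ≤ δ * ‖a‖ := by
  let χ : ContDiffBump x₀ := ⟨r', r, hr', hr⟩
  have hχs : ContDiff ℝ (⊤ : ℕ∞) χ := χ.contDiff
  obtain ⟨C, hC⟩ := hw.bounded
  obtain ⟨C', hC'⟩ := (hχs.continuous_fderiv (by simp)).bounded_above_of_compact_support
    (χ.hasCompactSupport.fderiv ℝ)
  have hC0 : 0 ≤ C := (abs_nonneg _).trans (hC 0)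
  have hC'0 : 0 ≤ C' := (norm_nonneg _).trans (hC' 0)
  let Λ : ℝ := (2 * C * C' + 1) / δ
  have hΛ : 0 < Λ := by positivity
  refine ⟨Λ, χ, fun x => ⟨χ.nonneg, χ.le_one⟩, fun x hx => χ.one_of_mem_closedBall hx, fun t => ?_⟩
  let h : E3 → ℝ := fun x => χ x * (Λ⁻¹ * P (Λ * inner ℝ ξ x + t))
  have hin : ContDiff ℝ (⊤ : ℕ∞) (fun x : E3 => Λ * inner ℝ ξ x + t) :=
    (contDiff_const.mul (contDiff_const.inner ℝ contDiff_id)).add contDiff_const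
  refine ⟨h, hχs.mul (contDiff_const.mul (hw.contDiff_primitive.comp hin)), ?_, ?_⟩
  · exact (tsupport_mul_subset_left).trans χ.tsupport_eq.subset
  intro a ha x
  set τ := Λ * inner ℝ ξ x + t
  have hd : ∀ v, fderiv ℝ h x v = χ x * (p τ - θ) * inner ℝ ξ v +
      Λ⁻¹ * P τ * fderiv ℝ χ x v := by
    intro v
    have h1 : HasFDerivAt χ (fderiv ℝ χ x) x := (hχs.differentiable (by simp) x).hasFDerivAt
    have h2 : HasFDerivAt (fun x : E3 => Λ * inner ℝ ξ x + t) (Λ • innerSL ℝ ξ) x :=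
      ((innerSL ℝ ξ).hasFDerivAt.const_mul Λ).add_const t
    have h3 := ((hw.hasDerivAt τ).comp_hasFDerivAt x h2).const_mul Λ⁻¹
    have h4 := (h1.mul h3).fderiv
    have h5 : fderiv ℝ h x = _ := h4
    rw [h5]
    simp only [Function.comp, add_apply, smul_apply,
      innerSL_apply_apply, smul_eq_mul]
    field_simp
    ring
  have hξξ : inner ℝ ξ ξ = (1 : ℝ) := by rw [real_inner_self_eq_norm_sq, hξ]; norm_num
  have e : rotField h ξ a x - (χ x * (p τ - θ)) • a =
      (Λ⁻¹ * P τ) • (fderiv ℝ χ x ξ • a - fderiv ℝ χ x a • ξ) := by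
    rw [rotField, hd, hd, ha, hξξ]
    module
  rw [e, norm_smul]
  have b1 : ‖Λ⁻¹ * P τ‖ ≤ Λ⁻¹ * C := by
    rw [norm_mul, Real.norm_of_nonneg (inv_nonneg.2 hΛ.le)]
    gcongr
    exact hC τ
  have b2 : ‖fderiv ℝ χ x ξ • a - fderiv ℝ χ x a • ξ‖ ≤ 2 * C' * ‖a‖ := by
    refine (norm_sub_le _ _).trans ?_
    rw [norm_smul, norm_smul, hξ, mul_one]
    have c1 : ‖fderiv ℝ χ x ξ‖ ≤ C' := by
      simpa [hξ] using (fderiv ℝ χ x).le_of_opNorm_le (hC' x) ξ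
    have c2 := (fderiv ℝ χ x).le_of_opNorm_le (hC' x) a
    have c3 := mul_le_mul_of_nonneg_right c1 (norm_nonneg a)
    linarith
  calc ‖Λ⁻¹ * P τ‖ * ‖fderiv ℝ χ x ξ • a - fderiv ℝ χ x a • ξ‖
      ≤ (Λ⁻¹ * C) * (2 * C' * ‖a‖) := by gcongr
    _ = (2 * C * C') / Λ * ‖a‖ := by field_simp
    _ ≤ δ * ‖a‖ := by
      gcongr
      rw [div_le_iff₀ hΛ]
      simp only [Λ]
      field_simp
      linarith

/-! ### Oscillating perturbations of constant fields on a ball -/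

theorem exists_measureReal_annulus_le {X : Type*} [PseudoMetricSpace X] [MeasurableSpace X]
    [OpensMeasurableSpace X] (μ : Measure X) [IsFiniteMeasure μ] (x₀ : X) {r : ℝ} (hr : 0 < r)
    (hs : μ (Metric.sphere x₀ r) = 0) {ε : ℝ} (hε : 0 < ε) :
    ∃ r', 0 < r' ∧ r' < r ∧ μ.real (Metric.closedBall x₀ r \ Metric.closedBall x₀ r') ≤ ε := by
  obtain ⟨u, hu, hur, hlim⟩ := exists_seq_strictMono_tendsto' hr
  let s : ℕ → Set X := fun n => Metric.closedBall x₀ r \ Metric.closedBall x₀ (u n)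
  have hanti : Antitone s := fun m n hmn =>
    sdiff_subset_sdiff_right (Metric.closedBall_subset_closedBall (hu.monotone hmn))
  have hinter : ⋂ n, s n ⊆ Metric.sphere x₀ r := by
    intro x hx
    rw [mem_iInter] at hx
    rw [Metric.mem_sphere]
    refine le_antisymm (hx 0).1 (le_of_tendsto hlim (Filter.Eventually.of_forall fun n => ?_))
    have := (hx n).2
    rw [Metric.mem_closedBall, not_le] at this
    exact this.le
  have ht := tendsto_measure_iInter_atTop (μ := μ) (s := s)
    (fun n => (measurableSet_closedBall.diff measurableSet_closedBall).nullMeasurableSet) hanti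
    ⟨0, measure_ne_top _ _⟩
  rw [measure_mono_null hinter hs] at ht
  have ht' := (ENNReal.tendsto_toReal ENNReal.zero_ne_top).comp ht
  obtain ⟨n, hn⟩ := (ht'.eventually_lt_const (by simpa using hε)).exists
  exact ⟨u n, (hur n).1, (hur n).2, hn.le⟩

theorem IsSquareWave.integral_combination_le {θ η : ℝ} {p P : ℝ → ℝ} (hw : IsSquareWave θ η p P)
    (a : ℝ) {b : ℝ} (hb : 0 ≤ b) (c : ℝ) :
    ∫ τ in (0 : ℝ)..1, (a + b * (p τ * (1 - p τ)) + c * (p τ * (1 - θ) + (1 - p τ) * θ)) ≤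
      a + b * η + c * (2 * θ * (1 - θ)) := by
  have hpc := hw.continuous
  have ii : ∀ f : ℝ → ℝ, Continuous f → IntervalIntegrable f volume 0 1 :=
    fun f hf => hf.intervalIntegrable _ _
  have e : ∀ τ, a + b * (p τ * (1 - p τ)) + c * (p τ * (1 - θ) + (1 - p τ) * θ) =
      b * (p τ * (1 - p τ)) + (c * (1 - 2 * θ) * p τ + (a + c * θ)) := fun τ => by ring
  simp only [e]
  rw [intervalIntegral.integral_add (ii _ (by fun_prop)) (ii _ (by fun_prop)),
    intervalIntegral.integral_add (ii _ (by fun_prop)) (ii _ (by fun_prop)),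
    intervalIntegral.integral_const_mul, intervalIntegral.integral_const_mul, hw.integral_eq,
    intervalIntegral.integral_const, sub_zero, one_smul]
  linarith [mul_le_mul_of_nonneg_left hw.integral_transition_le hb]

theorem setIntegral_le_of_le_add_indicator (μ : Measure E3) [IsFiniteMeasure μ] {B A : Set E3}
    (hB : IsCompact B) (hBm : MeasurableSet B) {F k : E3 → ℝ} (hF : Continuous F)
    (hk : Continuous k) (hA : MeasurableSet A) (hAB : A ⊆ B) {C K : ℝ}
    (h : ∀ x ∈ B, F x ≤ k x + C + A.indicator (fun _ => K) x) :
    ∫ x in B, F x ∂μ ≤ ∫ x in B, k x ∂μ + C * μ.real B + K * μ.real A := by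
  have i1 : IntegrableOn k B μ := hk.continuousOn.integrableOn_compact hB
  have i2 : IntegrableOn (A.indicator fun _ => K) B μ := (integrable_const K).indicator hA
  have i3 : IntegrableOn (fun _ : E3 => C) B μ := integrable_const _
  have hmono := setIntegral_mono_on (hF.continuousOn.integrableOn_compact hB)
    ((i1.add i3).add i2) hBm h
  refine hmono.trans (le_of_eq ?_)
  rw [integral_add' (i1.add i3) i2, integral_add' i1 i3, integral_indicator_const _ hA,
    setIntegral_const, measureReal_restrict_apply hA, inter_eq_left.2 hAB]
  simp only [smul_eq_mul]
  ring

set_option maxHeartbeats 400000 in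
/-- Three constant fields on a ball can be perturbed so that the integrated defect falls, up to `ε`,
to three quarters, while the total norm grows by at most `ε`. A pair whose minimum is at least
a third of the defect is split along `splitDir`. On average over the phase, this minimum disappears, and the two other minima do not grow. The average displacement is
`4 ‖z i‖ ‖z j‖ / (‖z i‖ + ‖z j‖)`, at most four times the minimum which disappears; with the weight
`1 / 48` this costs a twelfth of it, and `(11 / 12) / 3 ≥ 1 / 4`. -/
theorem exists_perturbation_closedBall (μ : Measure E3) [IsFiniteMeasure μ] (x₀ : E3) {r : ℝ}
    (hr : 0 < r) (hsph : μ (Metric.sphere x₀ r) = 0) (z : Fin 3 → E3) {ε : ℝ} (hε : 0 < ε) :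
    ∃ α : Fin 3 → E3 → E3, (∀ m, Continuous (α m)) ∧
      (∀ m, ∀ x ∉ Metric.closedBall x₀ r, α m x = 0) ∧
      (∀ Ω : Opens E3, Metric.closedBall x₀ r ⊆ Ω → ∀ m, HasZeroNormalTrace Ω (α m)) ∧
      (∀ x, ∑ m, ‖z m + α m x‖ ≤ ∑ m, ‖z m‖ + ε) ∧
      ∫ x in Metric.closedBall x₀ r,
        (defect (fun m => z m + α m x) + (1 / 48) * ∑ m, ‖α m x‖) ∂μ ≤
        3 / 4 * defect z * μ.real (Metric.closedBall x₀ r) + ε := by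
  obtain ⟨i, j, k, hij, hik, hjk, hpair⟩ := exists_pair_defect_le z
  rcases (le_min (norm_nonneg (z i)) (norm_nonneg (z j))).eq_or_lt with h0 | h0
  · refine ⟨fun _ _ => 0, fun _ => continuous_const, fun _ _ _ => rfl, fun Ω _ m p g _ => by simp,
      fun x => by simpa using hε.le, ?_⟩
    have : defect z = 0 := le_antisymm (by rw [← h0] at hpair; simpa using hpair) (defect_nonneg z)
    simpa [this] using hε.le
  have hi : 0 < ‖z i‖ := h0.trans_le (min_le_left _ _)
  have hj : 0 < ‖z j‖ := h0.trans_le (min_le_right _ _)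
  set N := ‖z i‖ + ‖z j‖ with hN
  have hN0 : 0 < N := by linarith
  set θ := ‖z i‖ / N with hθ
  have hθ0 : 0 < θ := by positivity
  have hθ1 : θ < 1 := by rw [hθ, div_lt_one hN0]; linarith
  set B := Metric.closedBall x₀ r with hB
  set V := μ.real B with hV
  have hV0 : 0 ≤ V := measureReal_nonneg
  set δ := ε / (18 * N * (V + 1)) with hδ
  have hδ0 : 0 < δ := by positivity
  have hδV : 6 * N * δ * V ≤ ε / 3 := by
    have : 6 * N * δ * V = ε / 3 * (V / (V + 1)) := by rw [hδ]; field_simp; ring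
    rw [this]
    exact mul_le_of_le_one_right (by positivity) ((div_le_one (by positivity)).2 (by linarith))
  have hδε : 2 * N * δ ≤ ε := by
    have : 2 * N * δ = ε * (1 / (9 * (V + 1))) := by rw [hδ]; field_simp; norm_num
    rw [this]
    exact mul_le_of_le_one_right hε.le ((div_le_one (by positivity)).2 (by linarith))
  -- a crude bound, used only on the annulus where the cutoff is not `1`
  set K := 2 * (∑ m, ‖z m‖ + ε) with hK
  have hS0 : 0 ≤ ∑ m, ‖z m‖ := Finset.sum_nonneg fun m _ => norm_nonneg _
  have hK0 : 0 < K := by rw [hK]; linarith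
  have hεK : 0 < ε / (3 * K) := div_pos hε (by linarith)
  obtain ⟨r', hr'0, hr'r, hann⟩ :=
    exists_measureReal_annulus_le μ x₀ hr hsph hεK
  obtain ⟨p, P, hw⟩ := exists_isSquareWave hθ0 hθ1 hδ0
  obtain ⟨ξ, hξ, hξi, hξj⟩ := exists_unit_orthogonal (z i) (z j)
  obtain ⟨Λ, χ, hχ, hχ1, hfield⟩ := exists_rotField_near_wave hw hξ x₀ hr'0 hr'r hδ0
  -- the bound for defect and displacement as a function of the phase
  set κ : ℝ → ℝ := fun τ => (min ‖z i‖ ‖z k‖ + min ‖z j‖ ‖z k‖) + 6 * N * (p τ * (1 - p τ)) +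
    N / 24 * (p τ * (1 - θ) + (1 - p τ) * θ) with hκ
  have hpc := hw.continuous
  have hκc : Continuous κ := by fun_prop
  have hκper : Function.Periodic κ 1 := fun τ => by simp only [hκ, hw.periodic τ]
  have hκ0 : ∀ τ, 0 ≤ κ τ := fun τ => by
    have := hw.nonneg τ
    have := sub_nonneg.2 (hw.le_one τ)
    have := sub_nonneg.2 hθ1.le
    positivity
  have hκint : ∫ τ in (0 : ℝ)..1, κ τ ≤ 3 / 4 * defect z + 6 * N * δ := by
    have e1 := hw.integral_combination_le (min ‖z i‖ ‖z k‖ + min ‖z j‖ ‖z k‖)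
      (by linarith : 0 ≤ 6 * N) (N / 24)
    -- `2 N θ (1 - θ) = 2 ‖z i‖ ‖z j‖ / N`
    have e3 : N / 24 * (2 * θ * (1 - θ)) ≤ 1 / 12 * min ‖z i‖ ‖z j‖ := by
      have hA : N * θ = ‖z i‖ := by rw [hθ]; field_simp
      have hB' : N * (1 - θ) = ‖z j‖ := by rw [mul_sub, hA, hN]; ring
      rw [mul_min_of_nonneg _ _ (by norm_num)]
      apply le_min
      · rw [← hA]; nlinarith [mul_pos hN0 hθ0]
      · rw [← hB']; nlinarith [mul_pos hN0 (sub_pos.2 hθ1)]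
    have e5 := defect_eq z hij hik hjk
    linarith
  have hφc : Continuous (fun x : E3 => Λ * inner ℝ ξ x) := by fun_prop
  obtain ⟨t, ht⟩ := exists_phase_integral_le (μ.restrict B) hκc hκper hφc
  obtain ⟨h, hhs, hhsupp, hnear⟩ := hfield t
  set d := splitDir z i j with hd
  have hdorth : ∀ m, inner ℝ ξ (d m) = 0 := by
    intro m
    simp only [hd, splitDir]
    split_ifs
    · rw [real_inner_smul_right, hξi, mul_zero]
    · rw [inner_neg_right, real_inner_smul_right, hξj, mul_zero, neg_zero]
    · exact inner_zero_right _
  have hdsum : ∑ m, ‖d m‖ = 2 * N := sum_norm_splitDir hij hik hjk hi hj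
  set α : Fin 3 → E3 → E3 := fun m => rotField h ξ (d m) with hα
  have hαc : ∀ m, Continuous (α m) := fun m => continuous_rotField hhs ξ (d m)
  -- the position on the splitting segment
  set q : E3 → ℝ := fun x => θ + χ x * (p (Λ * inner ℝ ξ x + t) - θ) with hq
  have hq0 : ∀ x, 0 ≤ q x := fun x => by
    have := hw.nonneg (Λ * inner ℝ ξ x + t)
    nlinarith [hχ x]
  have hq1 : ∀ x, q x ≤ 1 := fun x => by
    have := hw.le_one (Λ * inner ℝ ξ x + t)
    nlinarith [hχ x]
  have herr : ∀ x, ∑ m, ‖α m x - (q x - θ) • d m‖ ≤ 2 * N * δ := by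
    intro x
    calc ∑ m, ‖α m x - (q x - θ) • d m‖ ≤ ∑ m, δ * ‖d m‖ := by
          refine Finset.sum_le_sum fun m _ => ?_
          have := hnear (d m) (hdorth m) x
          simpa [hq, hα] using this
      _ = 2 * N * δ := by rw [← Finset.mul_sum, hdsum]; ring
  have hbound : ∀ x, ∑ m, ‖z m + α m x‖ ≤ ∑ m, ‖z m‖ + 2 * N * δ := by
    intro x
    calc ∑ m, ‖z m + α m x‖
        ≤ ∑ m, (‖z m + (q x - θ) • d m‖ + ‖α m x - (q x - θ) • d m‖) := by
          refine Finset.sum_le_sum fun m _ => ?_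
          refine le_trans (le_of_eq ?_) (norm_add_le _ _)
          congr 1
          abel
      _ ≤ ∑ m, ‖z m‖ + 2 * N * δ := by
          rw [Finset.sum_add_distrib, sum_norm_split hij hik hjk hi hj (hq0 x) (hq1 x)]
          linarith [herr x]
  refine ⟨α, hαc, fun m x hx => rotField_eq_zero (fun hx' => hx (hhsupp hx')) ξ (d m),
    fun Ω hΩ m => hasZeroNormalTrace_rotField hhs
      ((isCompact_closedBall x₀ r).of_isClosed_subset (isClosed_tsupport _) hhsupp)
      (hhsupp.trans hΩ) ξ (d m), fun x => (hbound x).trans (by linarith), ?_⟩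
  set F : E3 → ℝ := fun x => defect (fun m => z m + α m x) + (1 / 48) * ∑ m, ‖α m x‖ with hF
  set A := B \ Metric.closedBall x₀ r' with hA
  have hFK : ∀ x, F x ≤ K := by
    intro x
    have h1 := (defect_le_sum_norm fun m => z m + α m x).trans (hbound x)
    have h2 : ∑ m, ‖α m x‖ ≤ ∑ m, ‖z m + α m x‖ + ∑ m, ‖z m‖ := by
      rw [← Finset.sum_add_distrib]
      refine Finset.sum_le_sum fun m _ => ?_
      refine le_trans (le_of_eq ?_) (norm_sub_le _ _)
      congr 1
      abel
    have h3 := hbound x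
    simp only [hF, hK]
    linarith
  have hFin : ∀ x ∈ Metric.closedBall x₀ r', F x ≤ κ (Λ * inner ℝ ξ x + t) + 6 * N * δ := by
    intro x hx
    have hqp : q x = p (Λ * inner ℝ ξ x + t) := by simp [hq, hχ1 x hx]
    have h1 := defect_le_add (fun m => z m + α m x) (fun m => z m + (q x - θ) • d m)
    have h2 := defect_split_le hij hik hjk hi hj (hq0 x) (hq1 x)
    have h3 : ∑ m, ‖α m x‖ ≤ |q x - θ| * (2 * N) + 2 * N * δ := by
      calc ∑ m, ‖α m x‖ ≤ ∑ m, (|q x - θ| * ‖d m‖ + ‖α m x - (q x - θ) • d m‖) := by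
            refine Finset.sum_le_sum fun m _ => ?_
            have := norm_le_norm_add_norm_sub' (α m x) ((q x - θ) • d m)
            rwa [norm_smul, Real.norm_eq_abs] at this
        _ ≤ _ := by
            rw [Finset.sum_add_distrib, ← Finset.mul_sum, hdsum]
            linarith [herr x]
    have h4 : |q x - θ| ≤ q x * (1 - θ) + (1 - q x) * θ := by
      have a := mul_nonneg (hq0 x) (sub_nonneg.2 hθ1.le)
      have b := mul_nonneg (sub_nonneg.2 (hq1 x)) hθ0.le
      rw [abs_le]
      constructor <;> nlinarith
    have h5 : ∑ m, ‖(z m + α m x) - (z m + (q x - θ) • d m)‖ ≤ 2 * N * δ := by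
      simpa only [add_sub_add_left_eq_sub] using herr x
    have h6 := mul_le_mul_of_nonneg_right h4 (by positivity : 0 ≤ 2 * N)
    have h7 : 0 < N * δ := by positivity
    simp only [hF, hκ, ← hqp]
    simp only [← hN, ← hθ, ← hd] at h2
    linarith
  have hpt : ∀ x ∈ B, F x ≤ (κ (Λ * inner ℝ ξ x + t) + 6 * N * δ) + A.indicator (fun _ => K) x := by
    intro x hx
    by_cases hx' : x ∈ Metric.closedBall x₀ r'
    · rw [indicator_of_notMem fun h => h.2 hx', add_zero]
      exact hFin x hx'
    · rw [indicator_of_mem (show x ∈ A from ⟨hx, hx'⟩)]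
      have h7 : 0 < N * δ := by positivity
      linarith [hFK x, hκ0 (Λ * inner ℝ ξ x + t)]
  have hBc : IsCompact B := isCompact_closedBall x₀ r
  have hFc : Continuous F :=
    (continuous_defect.comp (continuous_pi fun m => continuous_const.add (hαc m))).add
      (continuous_const.mul (continuous_finsetSum _ fun m _ => (hαc m).norm))
  have hAm : MeasurableSet A := measurableSet_closedBall.diff measurableSet_closedBall
  have hint := setIntegral_le_of_le_add_indicator μ hBc measurableSet_closedBall hFc
    (k := fun x => κ (Λ * inner ℝ ξ x + t)) (hκc.comp (hφc.add continuous_const)) hAm sdiff_subset hpt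
  have hK1 : K * μ.real A ≤ ε / 3 := by
    refine (mul_le_mul_of_nonneg_left hann hK0.le).trans (le_of_eq ?_)
    field_simp
  rw [measureReal_restrict_apply_univ] at ht
  have h9 := ht.trans (mul_le_mul_of_nonneg_left hκint hV0)
  linarith

/-! ### The perturbation step -/

/-- The same for fields which are almost constant on the ball, by freezing them at the centre. -/
theorem exists_perturbation_closedBall_of_near (μ : Measure E3) [IsFiniteMeasure μ] (y : E3)
    {r : ℝ} (hr : 0 < r) (hsph : μ (Metric.sphere y r) = 0) {U : Fin 3 → E3 → E3}
    (hU : ∀ m, ContinuousOn (U m) (Metric.closedBall y r)) {δ ε : ℝ} (hε : 0 < ε)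
    (hnear : ∀ x ∈ Metric.closedBall y r, ∑ m, ‖U m x - U m y‖ ≤ δ) :
    ∃ α : Fin 3 → E3 → E3, (∀ m, Continuous (α m)) ∧
      (∀ m, ∀ x ∉ Metric.closedBall y r, α m x = 0) ∧
      (∀ Ω : Opens E3, Metric.closedBall y r ⊆ Ω → ∀ m, HasZeroNormalTrace Ω (α m)) ∧
      (∀ x ∈ Metric.closedBall y r, ∑ m, ‖U m x + α m x‖ ≤ ∑ m, ‖U m y‖ + δ + ε) ∧
      ∫ x in Metric.closedBall y r,
        (defect (fun m => U m x + α m x) + (1 / 48) * ∑ m, ‖α m x‖) ∂μ ≤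
        3 / 4 * (∫ x in Metric.closedBall y r, defect (fun m => U m x) ∂μ) +
          4 * δ * μ.real (Metric.closedBall y r) + ε := by
  obtain ⟨α, hc, hs, hz, hb, hi⟩ :=
    exists_perturbation_closedBall μ y hr hsph (fun m => U m y) hε
  set B := Metric.closedBall y r with hB
  have hBc : IsCompact B := isCompact_closedBall y r
  have hBm : MeasurableSet B := measurableSet_closedBall
  refine ⟨α, hc, hs, hz, fun x hx => ?_, ?_⟩
  · calc ∑ m, ‖U m x + α m x‖ ≤ ∑ m, (‖U m y + α m x‖ + ‖U m x - U m y‖) := by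
          refine Finset.sum_le_sum fun m _ => ?_
          refine le_trans (le_of_eq ?_) (norm_add_le _ _)
          congr 1
          abel
      _ ≤ ∑ m, ‖U m y‖ + δ + ε := by
          rw [Finset.sum_add_distrib]
          linarith [hb x, hnear x hx]
  · have hd : ∀ V : Fin 3 → E3 → E3, (∀ m, ContinuousOn (V m) B) →
        ContinuousOn (fun x => defect (fun m => V m x)) B := fun V hV =>
      continuous_defect.comp_continuousOn (continuousOn_pi.2 hV)
    have hn : ContinuousOn (fun x => (1 / 48 : ℝ) * ∑ m, ‖α m x‖) B :=
      (continuous_const.mul (continuous_finsetSum _ fun m _ => (hc m).norm)).continuousOn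
    have i1 : IntegrableOn
        (fun x => defect (fun m => U m x + α m x) + (1 / 48) * ∑ m, ‖α m x‖) B μ :=
      ((hd _ fun m => (hU m).add (hc m).continuousOn).add hn).integrableOn_compact hBc
    have i2 : IntegrableOn
        (fun x => defect (fun m => U m y + α m x) + (1 / 48) * ∑ m, ‖α m x‖) B μ :=
      ((hd _ fun m => continuousOn_const.add (hc m).continuousOn).add hn).integrableOn_compact hBc
    have i3 : IntegrableOn (fun x => defect (fun m => U m x)) B μ :=
      (hd _ hU).integrableOn_compact hBc
    have i4 : ∀ c : ℝ, IntegrableOn (fun _ : E3 => c) B μ := fun c => integrable_const c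
    have h1 := setIntegral_mono_on i1 (i2.add (i4 (2 * δ))) hBm (fun x hx => by
      have h := defect_le_add (fun m => U m x + α m x) (fun m => U m y + α m x)
      simp only [add_sub_add_right_eq_sub] at h
      have h' := hnear x hx
      simp only [Pi.add_apply]
      linarith)
    have h2 := setIntegral_mono_on (i4 (defect fun m => U m y)) (i3.add (i4 (2 * δ))) hBm
      (fun x hx => by
      have h := defect_le_add (fun m => U m y) (fun m => U m x)
      have h' := hnear x hx
      simp only [norm_sub_rev (U _ y)] at h
      simp only [Pi.add_apply]
      linarith)
    rw [integral_add' i2 (i4 _), setIntegral_const, smul_eq_mul] at h1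
    rw [integral_add' i3 (i4 _), setIntegral_const, setIntegral_const, smul_eq_mul,
      smul_eq_mul] at h2
    have h3 : 0 ≤ δ := (Finset.sum_nonneg fun m _ => norm_nonneg _).trans
      (hnear y (Metric.mem_closedBall_self hr.le))
    have h4 : 0 ≤ δ * μ.real B := mul_nonneg h3 measureReal_nonneg
    linarith

theorem exists_finset_measureReal_diff_le {X : Type*} [MeasurableSpace X] (μ : Measure X)
    [IsFiniteMeasure μ] {ι : Type*} {t : Set ι} (ht : t.Countable) {S : Set X} {B : ι → Set X}
    (hS : MeasurableSet S) (hB : ∀ i, MeasurableSet (B i)) (h0 : μ (S \ ⋃ i ∈ t, B i) = 0) {ε : ℝ}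
    (hε : 0 < ε) :
    ∃ T : Finset ι, (T : Set ι) ⊆ t ∧ μ.real (S \ ⋃ i ∈ T, B i) ≤ ε := by
  classical
  have := ht.to_subtype
  let s : Finset t → Set X := fun T => S \ ⋃ i ∈ T, B i
  have hanti : Antitone s := fun T T' h =>
    sdiff_subset_sdiff_right (biUnion_subset_biUnion_left h)
  have hinter : ⋂ T, s T ⊆ S \ ⋃ i ∈ t, B i := by
    intro x hx
    rw [mem_iInter] at hx
    refine ⟨(hx ∅).1, fun hx' => ?_⟩
    obtain ⟨i, hi, hxi⟩ := mem_iUnion₂.1 hx'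
    exact (hx {⟨i, hi⟩}).2 (mem_iUnion₂.2 ⟨⟨i, hi⟩, by simp, hxi⟩)
  have hlim := tendsto_measure_iInter_atTop (μ := μ) (s := s)
    (fun T => (hS.diff (Finset.measurableSet_biUnion T fun i _ => hB i)).nullMeasurableSet) hanti
    ⟨∅, measure_ne_top _ _⟩
  rw [measure_mono_null hinter h0] at hlim
  have hlim' := (ENNReal.tendsto_toReal ENNReal.zero_ne_top).comp hlim
  obtain ⟨T, hT⟩ := (hlim'.eventually_lt_const (by simpa using hε)).exists
  refine ⟨T.map (Function.Embedding.subtype _), ?_, ?_⟩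
  · intro i hi
    simp only [Finset.coe_map, mem_image] at hi
    obtain ⟨j, _, rfl⟩ := hi
    exact j.2
  · have : ⋃ i ∈ T.map (Function.Embedding.subtype _), B i = ⋃ i ∈ T, B i := by
      ext x; simp
    rw [this]
    exact hT.le

/-- One step of the construction: up to `ε`, the integral of the defect shrinks by the factor `3/4`,
at the price of a displacement which is controlled in `L¹` by the decrease. The fields are frozen on
finitely many disjoint balls given by the Besicovitch covering theorem. -/
theorem exists_perturbation_step (Ω : Opens E3) (μ : Measure E3) [IsFiniteMeasure μ]
    (hμ : μ ≪ volume) {U : Fin 3 → E3 → E3} (hU : ∀ m, ContinuousOn (U m) (Ω : Set E3)) {M : ℝ}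
    (hM : ∀ x ∈ Ω, ∑ m, ‖U m x‖ ≤ M) {ε : ℝ} (hε : 0 < ε) :
    ∃ α : Fin 3 → E3 → E3, (∀ m, Continuous (α m)) ∧ (∀ m, HasCompactSupport (α m)) ∧
      (∀ m, HasZeroNormalTrace Ω (α m)) ∧ (∀ x ∈ Ω, ∑ m, ‖U m x + α m x‖ ≤ M + ε) ∧
      ∫ x in (Ω : Set E3), (defect (fun m => U m x + α m x) + (1 / 48) * ∑ m, ‖α m x‖) ∂μ ≤
        3 / 4 * (∫ x in (Ω : Set E3), defect (fun m => U m x) ∂μ) + ε := by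
  set W := μ.real (Ω : Set E3) with hW
  have hW0 : 0 ≤ W := measureReal_nonneg
  obtain ⟨δ, hδ0, hδε, hδW⟩ : ∃ δ : ℝ, 0 < δ ∧ δ ≤ ε / 2 ∧ 4 * δ * W ≤ ε / 4 := by
    refine ⟨min (ε / 2) (ε / (16 * (W + 1))), lt_min (by positivity) (by positivity),
      min_le_left _ _, ?_⟩
    have h1 := mul_le_mul_of_nonneg_right (min_le_right (ε / 2) (ε / (16 * (W + 1)))) hW0
    have h2 : ε / (16 * (W + 1)) * W = ε / 16 * (W / (W + 1)) := by field_simp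
    have h3 : ε / 16 * (W / (W + 1)) ≤ ε / 16 :=
      mul_le_of_le_one_right (by positivity) ((div_le_one (by positivity)).2 (by linarith))
    linarith
  -- radii on which `U` is almost constant
  have hR : ∀ y ∈ (Ω : Set E3), ∃ R : ℝ, 0 < R ∧ Metric.ball y R ⊆ Ω ∧
      ∀ x ∈ Metric.ball y R, ∑ m, ‖U m x - U m y‖ ≤ δ := by
    intro y hy
    have hΩn : (Ω : Set E3) ∈ nhds y := Ω.isOpen.mem_nhds hy
    have hc : ContinuousAt (fun x => ∑ m, ‖U m x - U m y‖) y :=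
      tendsto_finsetSum _ fun m _ => (((hU m).continuousAt hΩn).sub continuousAt_const).norm
    have hev : ∀ᶠ x in nhds y, ∑ m, ‖U m x - U m y‖ < δ :=
      hc.eventually_lt_const (by simpa using hδ0)
    obtain ⟨R, hR, hRs⟩ := Metric.mem_nhds_iff.1 (Filter.inter_mem hΩn hev)
    exact ⟨R, hR, fun x hx => (hRs hx).1, fun x hx => (hRs hx).2.le⟩
  choose! R hR0 hRΩ hRU using hR
  obtain ⟨t, r, htc, htΩ, htr, htcov, htdisj⟩ :=
    Besicovitch.exists_disjoint_closedBall_covering_ae μ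
    (fun _ => univ) (Ω : Set E3) (fun x _ δ hδ => by simpa using hδ) R hR0
  have hM1 : 0 < 4 * (|M| + 1) := by positivity
  obtain ⟨T, hTt, hTμ⟩ := exists_finset_measureReal_diff_le μ htc
    (B := fun y => Metric.closedBall y (r y)) Ω.isOpen.measurableSet
    (fun _ => measurableSet_closedBall) htcov (ε := ε / (4 * (|M| + 1))) (by positivity)
  set B : E3 → Set E3 := fun y => Metric.closedBall y (r y) with hB
  have hr0 : ∀ y ∈ T, 0 < r y := fun y hy => (htr y (hTt hy)).2.1
  have hBR : ∀ y ∈ T, B y ⊆ Metric.ball y (R y) := fun y hy =>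
    Metric.closedBall_subset_ball (htr y (hTt hy)).2.2
  have hBΩ : ∀ y ∈ T, B y ⊆ Ω := fun y hy => (hBR y hy).trans (hRΩ y (htΩ (hTt hy)))
  have hdisj : (T : Set E3).PairwiseDisjoint B := htdisj.subset hTt
  set ε' := ε / (4 * (T.card + 1)) with hε'
  have hε'0 : 0 < ε' := by positivity
  have hε'2 : ε' ≤ ε / 2 := by
    rw [hε']
    have : (0 : ℝ) ≤ T.card := Nat.cast_nonneg _
    gcongr
    linarith
  have hε'T : T.card * ε' ≤ ε / 4 := by
    have : T.card * ε' = ε / 4 * (T.card / (T.card + 1)) := by rw [hε']; field_simp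
    rw [this]
    exact mul_le_of_le_one_right (by positivity) ((div_le_one (by positivity)).2 (by linarith))
  have hex : ∀ y ∈ T, _ := fun y hy =>
    exists_perturbation_closedBall_of_near μ y (hr0 y hy) (hμ (Measure.addHaar_sphere _ _ _))
      (fun m => (hU m).mono (hBΩ y hy)) hε'0
      (fun x hx => hRU y (htΩ (hTt hy)) x (hBR y hy hx))
  choose! a hac has haz hab hai using hex
  set α : Fin 3 → E3 → E3 := fun m x => ∑ y ∈ T, a y m x with hα
  have hαB : ∀ y ∈ T, ∀ x ∈ B y, ∀ m, α m x = a y m x := by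
    intro y hy x hx m
    refine Finset.sum_eq_single_of_mem y hy fun y' hy' hne => has y' hy' m x fun hx' => ?_
    exact (disjoint_left.1 (hdisj hy' hy hne)) hx' hx
  have hα0 : ∀ x, x ∉ ⋃ y ∈ T, B y → ∀ m, α m x = 0 := by
    intro x hx m
    refine Finset.sum_eq_zero fun y hy => has y hy m x fun hx' => hx ?_
    exact mem_iUnion₂.2 ⟨y, hy, hx'⟩
  have hαc : ∀ m, Continuous (α m) := fun m => continuous_finsetSum _ fun y hy => hac y hy m
  have hacs : ∀ y ∈ T, ∀ m, HasCompactSupport (a y m) := fun y hy m =>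
    HasCompactSupport.intro (isCompact_closedBall y (r y)) fun x hx => has y hy m x hx
  have hUα : ∀ x ∈ Ω, ∑ m, ‖U m x + α m x‖ ≤ M + ε := by
    intro x hx
    by_cases hxB : x ∈ ⋃ y ∈ T, B y
    · obtain ⟨y, hy, hxy⟩ := mem_iUnion₂.1 hxB
      simp only [hαB y hy x hxy]
      linarith [hab y hy x hxy, hM y (htΩ (hTt hy))]
    · simp only [hα0 x hxB, add_zero]
      linarith [hM x hx]
  refine ⟨α, hαc, fun m => ?_, fun m => ?_, hUα, ?_⟩
  · exact HasCompactSupport.intro (T.isCompact_biUnion fun y _ => isCompact_closedBall y (r y))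
      fun x hx => hα0 x hx m
  · have := HasZeroNormalTrace.sum (Ω := Ω) (s := T) (v := fun y => a y m) (c := fun _ => 1)
      (fun y hy => ((hac y hy m).memLp_of_hasCompactSupport (hacs y hy m)).restrict _)
      (fun y hy => haz y hy Ω (hBΩ y hy) m)
    simpa only [one_smul] using this
  set F : E3 → ℝ := fun x => defect (fun m => U m x + α m x) + (1 / 48) * ∑ m, ‖α m x‖ with hF
  set G : E3 → ℝ := fun x => defect (fun m => U m x) with hG
  have hΩm : MeasurableSet (Ω : Set E3) := Ω.isOpen.measurableSet
  have hGM : ∀ x ∈ Ω, G x ≤ M := fun x hx => (defect_le_sum_norm _).trans (hM x hx)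
  have hG0 : ∀ x, 0 ≤ G x := fun x => defect_nonneg _
  have hGc : ContinuousOn G Ω := continuous_defect.comp_continuousOn (continuousOn_pi.2 hU)
  have hnc : ContinuousOn (fun x => (1 / 48 : ℝ) * ∑ m, ‖α m x‖) Ω :=
    (continuous_const.mul (continuous_finsetSum _ fun m _ => (hαc m).norm)).continuousOn
  have hFc : ContinuousOn F Ω :=
    (continuous_defect.comp_continuousOn
      (continuousOn_pi.2 fun m => (hU m).add (hαc m).continuousOn)).add hnc
  have hGi : IntegrableOn G Ω μ := by
    refine Integrable.of_bound (hGc.aestronglyMeasurable hΩm) M ?_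
    filter_upwards [ae_restrict_mem hΩm] with x hx
    rw [Real.norm_of_nonneg (hG0 x)]
    exact hGM x hx
  have hFi : IntegrableOn F Ω μ := by
    refine Integrable.of_bound (hFc.aestronglyMeasurable hΩm) (3 * (|M| + ε)) ?_
    filter_upwards [ae_restrict_mem hΩm] with x hx
    have h1 := hUα x hx
    have h2 := (defect_le_sum_norm fun m => U m x + α m x).trans h1
    have h3 : ∑ m, ‖α m x‖ ≤ ∑ m, ‖U m x + α m x‖ + ∑ m, ‖U m x‖ := by
      rw [← Finset.sum_add_distrib]
      refine Finset.sum_le_sum fun m _ => ?_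
      refine le_trans (le_of_eq ?_) (norm_sub_le _ _)
      congr 1
      abel
    have h4 := hM x hx
    have h5 : 0 ≤ ∑ m, ‖α m x‖ := Finset.sum_nonneg fun m _ => norm_nonneg _
    have h6 := defect_nonneg fun m => U m x + α m x
    rw [Real.norm_of_nonneg (by simp only [hF]; positivity)]
    simp only [hF]
    linarith [le_abs_self M]
  set C := ⋃ y ∈ T, B y with hC
  have hCm : MeasurableSet C := Finset.measurableSet_biUnion T fun y _ => measurableSet_closedBall
  have hCΩ : C ⊆ Ω := iUnion₂_subset hBΩ
  have hsplit : ∀ H : E3 → ℝ, IntegrableOn H Ω μ →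
      ∫ x in (Ω : Set E3), H x ∂μ =
        ∑ y ∈ T, ∫ x in B y, H x ∂μ + ∫ x in (Ω : Set E3) \ C, H x ∂μ := by
    intro H hH
    rw [setIntegral_sdiff hCm hH hCΩ, hC,
      integral_biUnion_finset T (fun y _ => measurableSet_closedBall) hdisj
      (fun y hy => hH.mono_set (hBΩ y hy))]
    ring
  have hrest : ∫ x in (Ω : Set E3) \ C, F x ∂μ = ∫ x in (Ω : Set E3) \ C, G x ∂μ := by
    refine setIntegral_congr_fun (hΩm.diff hCm) fun x hx => ?_
    simp [hF, hG, hα0 x hx.2]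
  have hrest' : ∫ x in (Ω : Set E3) \ C, G x ∂μ ≤ ε / 4 := by
    calc ∫ x in (Ω : Set E3) \ C, G x ∂μ ≤ ∫ x in (Ω : Set E3) \ C, (|M| + 1) ∂μ := by
          refine setIntegral_mono_on (hGi.mono_set sdiff_subset) (integrable_const _)
            (hΩm.diff hCm) fun x hx => ?_
          linarith [hGM x hx.1, le_abs_self M]
      _ = μ.real ((Ω : Set E3) \ C) * (|M| + 1) := by rw [setIntegral_const, smul_eq_mul]
      _ ≤ ε / (4 * (|M| + 1)) * (|M| + 1) := by gcongr
      _ = ε / 4 := by field_simp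
  have hballs : ∑ y ∈ T, ∫ x in B y, F x ∂μ ≤
      3 / 4 * ∑ y ∈ T, ∫ x in B y, G x ∂μ + 4 * δ * W + T.card * ε' := by
    have h1 : ∀ y ∈ T, ∫ x in B y, F x ∂μ ≤
        3 / 4 * (∫ x in B y, G x ∂μ) + 4 * δ * μ.real (B y) + ε' := by
      intro y hy
      refine le_trans (le_of_eq ?_) (hai y hy)
      refine setIntegral_congr_fun measurableSet_closedBall fun x hx => ?_
      simp only [hF, hαB y hy x hx]
    have h2 : ∑ y ∈ T, μ.real (B y) ≤ W := by
      rw [← measureReal_biUnion_finset hdisj fun y _ => measurableSet_closedBall]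
      exact measureReal_mono hCΩ
    refine (Finset.sum_le_sum h1).trans ?_
    rw [Finset.sum_add_distrib, Finset.sum_add_distrib, ← Finset.mul_sum, ← Finset.mul_sum,
      Finset.sum_const, nsmul_eq_mul]
    have := mul_le_mul_of_nonneg_left h2 (by positivity : 0 ≤ 4 * δ)
    linarith
  rw [hsplit F hFi, hsplit G hGi, hrest]
  linarith

/-! ### Convergence of the iteration -/

theorem ae_summable_of_summable_integral {X : Type*} [MeasurableSpace X] {μ : Measure X}
    {f : ℕ → X → ℝ} (hf : ∀ n, Integrable (f n) μ) (h0 : ∀ n x, 0 ≤ f n x)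
    (hs : Summable fun n => ∫ x, f n x ∂μ) : ∀ᵐ x ∂μ, Summable fun n => f n x := by
  have h := summable_norm_of_tsum_eLpNorm_ne_top le_rfl (fun n => (hf n).1) (by
    have e : ∀ n, eLpNorm (f n) 1 μ = ENNReal.ofReal (∫ x, f n x ∂μ) := fun n => by
      rw [eLpNorm_one_eq_lintegral_enorm, ofReal_integral_eq_lintegral_ofReal (hf n)
        (ae_of_all _ (h0 n))]
      exact lintegral_congr fun x => Real.enorm_of_nonneg (h0 n x)
    simp only [e]
    exact hs.tsum_ofReal_ne_top)
  filter_upwards [h] with x hx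
  simpa only [Real.norm_of_nonneg (h0 _ x)] using hx

/-- Three bounded continuous fields can be changed by fields orthogonal to all gradients so that
almost everywhere at most one of them is nonzero. -/
theorem exists_disjoint_fields (Ω : Opens E3) {w : Fin 3 → E3 → E3}
    (hw : ∀ m, ContinuousOn (w m) (Ω : Set E3)) {M : ℝ} (hM : ∀ x ∈ Ω, ∑ m, ‖w m x‖ ≤ M) :
    ∃ u : Fin 3 → E3 → E3, (∀ m, StronglyMeasurable (u m)) ∧
      (∃ C : ℝ, ∀ m, ∀ᵐ x ∂volume.restrict (Ω : Set E3), ‖u m x‖ ≤ C) ∧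
      (∀ m, HasZeroNormalTrace Ω (fun x => u m x - w m x)) ∧
      ∀ᵐ x ∂volume.restrict (Ω : Set E3), defect (fun m => u m x) = 0 := by
  have hΩm : MeasurableSet (Ω : Set E3) := Ω.isOpen.measurableSet
  -- the defect need not be integrable for the Lebesgue measure when `Ω` is unbounded, so defects are
  -- measured by an equivalent finite measure
  let μ : Measure E3 := (volume : Measure E3).toFinite
  have hμ : μ ≪ volume := toFinite_absolutelyContinuous volume
  have hμ' : (volume : Measure E3) ≪ μ := absolutelyContinuous_toFinite volume
  let Q : ℕ → (Fin 3 → E3 → E3) → Prop := fun n A => (∀ m, Continuous (A m)) ∧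
    (∀ m, HasCompactSupport (A m)) ∧ (∀ m, HasZeroNormalTrace Ω (A m)) ∧
    ∀ x ∈ Ω, ∑ m, ‖w m x + A m x‖ ≤ M + ∑ i ∈ Finset.range n, (1 / 2 : ℝ) ^ i
  have hmem : ∀ α : E3 → E3, Continuous α → HasCompactSupport α →
      MemLp α ∞ (volume.restrict (Ω : Set E3)) := fun α hc hs =>
    (hc.memLp_of_hasCompactSupport hs).restrict _
  have hstep : ∀ n A, Q n A → ∃ A', Q (n + 1) A' ∧
      ∫ x in (Ω : Set E3), (defect (fun m => w m x + A' m x) +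
        (1 / 48) * ∑ m, ‖A' m x - A m x‖) ∂μ ≤
      3 / 4 * (∫ x in (Ω : Set E3), defect (fun m => w m x + A m x) ∂μ) + (1 / 2 : ℝ) ^ n := by
    rintro n A ⟨hc, hs, hz, hb⟩
    obtain ⟨α, hαc, hαs, hαz, hαb, hαi⟩ := exists_perturbation_step Ω μ hμ
      (U := fun m x => w m x + A m x) (fun m => (hw m).add (hc m).continuousOn) hb
      (ε := (1 / 2 : ℝ) ^ n) (by positivity)
    refine ⟨fun m x => A m x + α m x, ⟨fun m => (hc m).add (hαc m), fun m => (hs m).add (hαs m),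
      fun m => HasZeroNormalTrace.add (hmem _ (hc m) (hs m)) (hmem _ (hαc m) (hαs m)) (hz m) (hαz m),
      fun x hx => ?_⟩, ?_⟩
    · rw [Finset.sum_range_succ, ← add_assoc]
      simpa only [add_assoc] using hαb x hx
    · simpa only [add_assoc, add_sub_cancel_left] using hαi
  choose! next hnextQ hnextI using hstep
  let A : ℕ → Fin 3 → E3 → E3 := fun n => Nat.rec (fun _ _ => 0) (fun n A => next n A) n
  have hA : ∀ n, Q n (A n) := by
    intro n
    induction n with
    | zero =>
      refine ⟨fun _ => continuous_const, fun _ => HasCompactSupport.zero, fun _ p g _ => ?_,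
        fun x hx => ?_⟩
      · simp [A]
      · simpa [A] using hM x hx
    | succ n ih => exact hnextQ n (A n) ih
  have hAi := fun n => hnextI n (A n) (hA n)
  have hgeom : ∀ n, ∑ i ∈ Finset.range n, (1 / 2 : ℝ) ^ i ≤ 2 := fun n =>
    sum_geometric_two_le n
  have hUM : ∀ n, ∀ x ∈ Ω, ∑ m, ‖w m x + A n m x‖ ≤ M + 2 := fun n x hx =>
    ((hA n).2.2.2 x hx).trans (by linarith [hgeom n])
  let D : ℕ → E3 → ℝ := fun n x => defect (fun m => w m x + A n m x)
  let d : ℕ → E3 → ℝ := fun n x => ∑ m, ‖A (n + 1) m x - A n m x‖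
  have hD0 : ∀ n x, 0 ≤ D n x := fun n x => defect_nonneg _
  have hd0 : ∀ n x, 0 ≤ d n x := fun n x => Finset.sum_nonneg fun m _ => norm_nonneg _
  have hDi : ∀ n, IntegrableOn (D n) Ω μ := by
    intro n
    have hc : ContinuousOn (D n) Ω := continuous_defect.comp_continuousOn
      (continuousOn_pi.2 fun m => (hw m).add ((hA n).1 m).continuousOn)
    refine Integrable.of_bound (hc.aestronglyMeasurable hΩm) (M + 2) ?_
    filter_upwards [ae_restrict_mem hΩm] with x hx
    rw [Real.norm_of_nonneg (hD0 n x)]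
    exact (defect_le_sum_norm _).trans (hUM n x hx)
  have hdi : ∀ n, IntegrableOn (d n) Ω μ := by
    intro n
    refine integrable_finsetSum _ fun m _ => ?_
    have hc := ((hA (n + 1)).1 m).sub ((hA n).1 m)
    have hs : HasCompactSupport (A (n + 1) m - A n m) := ((hA (n + 1)).2.1 m).sub ((hA n).2.1 m)
    exact (hc.integrable_of_hasCompactSupport hs).norm.integrableOn
  let E : ℕ → ℝ := fun n => ∫ x in (Ω : Set E3), D n x ∂μ
  have hE0 : ∀ n, 0 ≤ E n := fun n => integral_nonneg (hD0 n)
  -- summing the estimates of all steps, the integrals of the defects telescope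
  let f : ℕ → E3 → ℝ := fun n x => 1 / 4 * D n x + 1 / 48 * d n x
  have hf0 : ∀ n x, 0 ≤ f n x := fun n x => by
    have := hD0 n x
    have := hd0 n x
    positivity
  have hfi : ∀ n, IntegrableOn (f n) Ω μ := fun n =>
    ((hDi n).const_mul _).add ((hdi n).const_mul _)
  have hfint : ∀ n, ∫ x in (Ω : Set E3), f n x ∂μ ≤ E n - E (n + 1) + (1 / 2 : ℝ) ^ n := by
    intro n
    have h1 : E (n + 1) + 1 / 48 * ∫ x in (Ω : Set E3), d n x ∂μ ≤ 3 / 4 * E n + (1 / 2 : ℝ) ^ n := by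
      refine le_trans (le_of_eq ?_) (hAi n)
      rw [← integral_const_mul, ← integral_add (hDi (n + 1)) ((hdi n).const_mul _)]
    have h2 : ∫ x in (Ω : Set E3), f n x ∂μ = 1 / 4 * E n + 1 / 48 * ∫ x in (Ω : Set E3), d n x ∂μ := by
      rw [integral_add ((hDi n).const_mul _) ((hdi n).const_mul _), integral_const_mul,
        integral_const_mul]
    linarith
  have hsum : Summable fun n => ∫ x in (Ω : Set E3), f n x ∂μ := by
    refine summable_of_sum_range_le (c := E 0 + 2) (fun n => integral_nonneg (hf0 n)) fun n => ?_
    calc ∑ i ∈ Finset.range n, ∫ x in (Ω : Set E3), f i x ∂μ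
        ≤ ∑ i ∈ Finset.range n, ((E i - E (i + 1)) + (1 / 2 : ℝ) ^ i) :=
          Finset.sum_le_sum fun i _ => hfint i
      _ ≤ E 0 + 2 := by
          rw [Finset.sum_add_distrib, Finset.sum_range_sub']
          linarith [hgeom n, hE0 n]
  have hae : ∀ᵐ x ∂volume.restrict (Ω : Set E3), Summable fun n => f n x :=
    (hμ'.restrict Ω).ae_le (ae_summable_of_summable_integral hfi hf0 hsum)
  have hlim : ∀ᵐ x ∂volume.restrict (Ω : Set E3), ∀ m, ∃ l,
      Filter.Tendsto (fun n => w m x + A n m x) Filter.atTop (nhds l) := by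
    filter_upwards [hae] with x hx m
    have hd : Summable fun n => 48 * f n x := hx.mul_left 48
    refine cauchySeq_tendsto_of_complete (cauchySeq_of_dist_le_of_summable _ (fun n => ?_) hd)
    rw [dist_add_left, dist_comm, dist_eq_norm]
    have h1 : ‖A (n + 1) m x - A n m x‖ ≤ d n x :=
      Finset.single_le_sum (f := fun m => ‖A (n + 1) m x - A n m x‖) (fun _ _ => norm_nonneg _)
        (Finset.mem_univ m)
    have h2 := hD0 n x
    simp only [f]
    linarith
  have hUm : ∀ n m, AEStronglyMeasurable (fun x => w m x + A n m x)
      (volume.restrict (Ω : Set E3)) := fun n m =>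
    ((hw m).add ((hA n).1 m).continuousOn).aestronglyMeasurable hΩm
  have hex : ∀ m, ∃ u : E3 → E3, StronglyMeasurable u ∧ ∀ᵐ x ∂volume.restrict (Ω : Set E3),
      Filter.Tendsto (fun n => w m x + A n m x) Filter.atTop (nhds (u x)) := fun m =>
    exists_stronglyMeasurable_limit_of_tendsto_ae (fun n => hUm n m)
      (hlim.mono fun x hx => hx m)
  choose u hum hut using hex
  have hwb : ∀ m, ∀ x ∈ Ω, ‖w m x‖ ≤ M := fun m x hx =>
    (Finset.single_le_sum (f := fun m => ‖w m x‖) (fun _ _ => norm_nonneg _)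
      (Finset.mem_univ m)).trans (hM x hx)
  have hUb : ∀ n m, ∀ x ∈ Ω, ‖w m x + A n m x‖ ≤ M + 2 := fun n m x hx =>
    (Finset.single_le_sum (f := fun m => ‖w m x + A n m x‖) (fun _ _ => norm_nonneg _)
      (Finset.mem_univ m)).trans (hUM n x hx)
  refine ⟨u, hum, ⟨M + 2, fun m => ?_⟩, fun m => ?_, ?_⟩
  · filter_upwards [hut m, ae_restrict_mem hΩm] with x hx hxΩ
    exact le_of_tendsto hx.norm (Filter.Eventually.of_forall fun n => hUb n m x hxΩ)
  · refine HasZeroNormalTrace.of_tendsto (u := fun n => A n m) (C := 2 * M + 2)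
      (fun n => ((hA n).1 m).aestronglyMeasurable) (fun n => ?_) (fun n => (hA n).2.2.1 m) ?_
    · filter_upwards [ae_restrict_mem hΩm] with x hx
      have h1 := norm_sub_le (w m x + A n m x) (w m x)
      rw [add_sub_cancel_left] at h1
      linarith [hUb n m x hx, hwb m x hx]
    · filter_upwards [hut m] with x hx
      simpa using hx.sub_const (w m x)
  · filter_upwards [hae, ae_all_iff.2 hut] with x hx hux
    have h1 : Filter.Tendsto (fun n => D n x) Filter.atTop (nhds (defect fun m => u m x)) :=
      (continuous_defect.tendsto _).comp (tendsto_pi_nhds.2 hux)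
    have h2 : Filter.Tendsto (fun n => D n x) Filter.atTop (nhds 0) := by
      refine squeeze_zero (hD0 · x) (fun n => ?_) (by simpa using hx.tendsto_atTop_zero.const_mul 4)
      have := hd0 n x
      simp only [f]
      linarith
    exact tendsto_nhds_unique h1 h2

/-! ### The density -/

/-- The density with values `1`, `2`, `3` where the first, second, third of three fields is nonzero.
Its value where all fields vanish is immaterial and is set to `3`. -/
noncomputable def indexDensity (u : Fin 3 → E3 → E3) (x : E3) : ℝ :=
  open scoped Classical in if u 0 x ≠ 0 then 1 else if u 1 x ≠ 0 then 2 else 3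

theorem measurable_indexDensity {u : Fin 3 → E3 → E3} (hu : ∀ m, StronglyMeasurable (u m)) :
    Measurable (indexDensity u) := by
  have h : ∀ m, MeasurableSet {x | u m x ≠ 0} := fun m =>
    ((hu m).measurable (measurableSet_singleton 0)).compl
  exact Measurable.ite (h 0) measurable_const (Measurable.ite (h 1) measurable_const
    measurable_const)

theorem one_le_indexDensity (u : Fin 3 → E3 → E3) (x : E3) : 1 ≤ indexDensity u x := by
  unfold indexDensity
  split_ifs <;> norm_num

theorem indexDensity_le (u : Fin 3 → E3 → E3) (x : E3) : indexDensity u x ≤ 3 := by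
  unfold indexDensity
  split_ifs <;> norm_num

/-- Where at most one field is nonzero, every function of the density acts linearly on the fields. -/
theorem indexDensity_smul_sum {u : Fin 3 → E3 → E3} {x : E3} (hx : defect (fun m => u m x) = 0)
    (b : ℝ → ℝ) : b (indexDensity u x) • ∑ m, u m x = ∑ m : Fin 3, b ((m : ℕ) + 1) • u m x := by
  have hmin : ∀ a c : E3, min ‖a‖ ‖c‖ = 0 → a = 0 ∨ c = 0 := by
    intro a c h
    rcases min_choice ‖a‖ ‖c‖ with h' | h'
    · exact Or.inl (norm_eq_zero.1 (h'.symm.trans h))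
    · exact Or.inr (norm_eq_zero.1 (h'.symm.trans h))
  have h0 : ∀ a c : E3, 0 ≤ min ‖a‖ ‖c‖ := fun a c => by positivity
  unfold defect at hx
  have p01 := h0 (u 0 x) (u 1 x)
  have p02 := h0 (u 0 x) (u 2 x)
  have p12 := h0 (u 1 x) (u 2 x)
  have h01 := hmin (u 0 x) (u 1 x) (by linarith)
  have h02 := hmin (u 0 x) (u 2 x) (by linarith)
  have h12 := hmin (u 1 x) (u 2 x) (by linarith)
  have e2 : (1 : ℝ) + 1 = 2 := by norm_num
  have e3 : (2 : ℝ) + 1 = 3 := by norm_num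
  rw [Fin.sum_univ_three, Fin.sum_univ_three]
  unfold indexDensity
  by_cases h : u 0 x = 0
  · by_cases h' : u 1 x = 0
    · simp [h, h', e3]
    · simp [h, h', e2, h12.resolve_left h']
  · simp [h, h01.resolve_left h, h02.resolve_left h]

theorem integrable_fderiv_testFunction_apply {Ω : Opens E3} {v : E3 → E3}
    (hv : MemLp v ∞ (volume.restrict (Ω : Set E3))) (ψ : 𝓓(Ω, ℝ)) :
    Integrable (fun x => fderiv ℝ ψ x (v x)) (volume.restrict (Ω : Set E3)) := by
  refine (integrable_inner_of_memLp_top hv (isSobolevWithGradient_testFunction ψ).2.1).congr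
    (ae_of_all _ fun x => ?_)
  simp only
  rw [real_inner_comm]
  simp [gradient]

theorem HasZeroNormalTrace.mem_solenoidalSpace {Ω : Opens E3} {v : E3 → E3}
    (hm : MemLp v ∞ (volume.restrict (Ω : Set E3))) (hv : HasZeroNormalTrace Ω v)
    (hΩ : volume (Ω : Set E3) < ∞) : v ∈ solenoidalSpace Ω := by
  have : IsFiniteMeasure (volume.restrict (Ω : Set E3)) := ⟨by simpa using hΩ⟩
  exact ⟨hm.mono_exponent le_top, fun p g hpg =>
    hv p g ⟨hpg.1.mono_exponent one_le_two, hpg.2.1.mono_exponent one_le_two, hpg.2.2⟩⟩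

theorem theorem1p1 (Ω : Opens E3) (hΩ : IsLipschitzDomain Ω)
    (β : ℝ → ℝ) (hβ : ∃ m : ℝ, 0 < m ∧ StrongConvexOn (Ioi (0 : ℝ)) m β)
    (f : 𝓓'(Ω, ℝ))
    (hf : ∃ w : E3 → E3, ContinuousOn w (Ω : Set E3) ∧
      (∃ M : ℝ, ∀ x ∈ Ω, ‖w x‖ ≤ M) ∧ IsDistribDiv Ω w f) :
    ∃ (v : E3 → E3) (ρ : E3 → ℝ),
      MemLp v ∞ (volume.restrict (Ω : Set E3)) ∧
      MemLp ρ ∞ (volume.restrict (Ω : Set E3)) ∧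
      (∃ c : ℝ, 0 < c ∧ ∀ᵐ x ∂(volume.restrict (Ω : Set E3)), c ≤ ρ x) ∧
      IsDistribDiv Ω (fun x => ρ x • v x) 0 ∧
      IsDistribDiv Ω v 0 ∧
      HasZeroNormalTrace Ω v ∧
      (volume (Ω : Set E3) < ∞ → v ∈ solenoidalSpace Ω) ∧
      IsDistribDiv Ω (fun x => β (ρ x) • v x) f := by
  obtain ⟨w, hwc, ⟨M, hwM⟩, hwdiv⟩ := hf
  have hΩm : MeasurableSet (Ω : Set E3) := Ω.isOpen.measurableSet
  -- convexity makes the second difference of `β` at `1, 2, 3` nonzero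
  have hpos : 0 < β 1 - 2 * β 2 + β 3 := by
    obtain ⟨m, hm, hconv⟩ := hβ
    have h := (hconv.strictConvexOn hm).2 (mem_Ioi.2 one_pos) (mem_Ioi.2 three_pos)
      (by norm_num) (one_half_pos (α := ℝ)) one_half_pos (add_halves 1)
    have e : (1 / 2 : ℝ) • (1 : ℝ) + (1 / 2 : ℝ) • (3 : ℝ) = 2 := by norm_num
    rw [e] at h
    simp only [smul_eq_mul] at h
    linarith
  set k := (β 1 - 2 * β 2 + β 3)⁻¹ with hk
  have hk1 : k * (β 1 - 2 * β 2 + β 3) = 1 := inv_mul_cancel₀ hpos.ne'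
  -- the second difference annihilates affine functions, so `c` gives `div v = div (ρ v) = 0`
  let c : Fin 3 → ℝ := ![k, -2 * k, k]
  obtain ⟨u, hum, ⟨C, huC⟩, huz, hud⟩ := exists_disjoint_fields Ω
    (w := fun m x => c m • w x) (fun m => hwc.const_smul (c m))
    (M := (∑ m, |c m|) * M) (fun x hx => by
      simp only [norm_smul, Real.norm_eq_abs]
      rw [← Finset.sum_mul]
      exact mul_le_mul_of_nonneg_left (hwM x hx) (Finset.sum_nonneg fun _ _ => abs_nonneg _))
  have hwm : MemLp w ∞ (volume.restrict (Ω : Set E3)) :=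
    memLp_top_of_bound (hwc.aestronglyMeasurable hΩm) M
      ((ae_restrict_mem hΩm).mono fun x hx => hwM x hx)
  have huL : ∀ m, MemLp (u m) ∞ (volume.restrict (Ω : Set E3)) := fun m =>
    memLp_top_of_bound (hum m).aestronglyMeasurable C (huC m)
  have hdL : ∀ m, MemLp (fun x => u m x - c m • w x) ∞ (volume.restrict (Ω : Set E3)) :=
    fun m => (huL m).sub (hwm.const_smul (c m))
  let v : E3 → E3 := fun x => ∑ m, u m x
  let ρ : E3 → ℝ := indexDensity u
  have hlin : ∀ b : ℝ → ℝ, MemLp (fun x => b (ρ x) • v x) ∞ (volume.restrict (Ω : Set E3)) := by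
    intro b
    have h : MemLp (fun x => ∑ m : Fin 3, b ((m : ℕ) + 1) • u m x) ∞
        (volume.restrict (Ω : Set E3)) :=
      memLp_finsetSum _ fun m _ => (huL m).const_smul (b ((m : ℕ) + 1))
    refine h.ae_eq ?_
    filter_upwards [hud] with x hx
    exact (indexDensity_smul_sum hx b).symm
  -- `b(ρ) v` equals the second difference of `b` times `k w` up to a field orthogonal to gradients
  have hzero : ∀ b : ℝ → ℝ, HasZeroNormalTrace Ω
      (fun x => b (ρ x) • v x - (k * (b 1 - 2 * b 2 + b 3)) • w x) := by
    intro b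
    refine (HasZeroNormalTrace.sum (s := Finset.univ) (c := fun m : Fin 3 => b ((m : ℕ) + 1))
      (fun m _ => hdL m) fun m _ => huz m).congr_ae ?_
    filter_upwards [hud] with x hx
    rw [indexDensity_smul_sum hx b, Fin.sum_univ_three, Fin.sum_univ_three]
    have e2 : (1 : ℝ) + 1 = 2 := by norm_num
    have e3 : (2 : ℝ) + 1 = 3 := by norm_num
    simp only [c, Matrix.cons_val_zero, Matrix.cons_val_one, Matrix.cons_val, Fin.isValue,
      Fin.coe_ofNat_eq_mod, Nat.zero_mod, Nat.one_mod, Nat.reduceMod, Nat.cast_zero, Nat.cast_one,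
      Nat.cast_ofNat, zero_add, e2, e3]
    module
  have hvL : MemLp v ∞ (volume.restrict (Ω : Set E3)) := by simpa using hlin fun _ => 1
  have hvz : HasZeroNormalTrace Ω v := by
    have h := hzero fun _ => 1
    have e : (1 : ℝ) - 2 * 1 + 1 = 0 := by norm_num
    simpa only [one_smul, e, mul_zero, zero_smul, sub_zero] using h
  have hρz : HasZeroNormalTrace Ω (fun x => ρ x • v x) := by
    have h := hzero fun s => s
    have e : (1 : ℝ) - 2 * 2 + 3 = 0 := by norm_num
    simpa only [e, mul_zero, zero_smul, sub_zero] using h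
  refine ⟨v, ρ, hvL, ?_, ⟨1, one_pos, ae_of_all _ fun x => one_le_indexDensity u x⟩,
    hρz.isDistribDiv_zero (hlin fun s => s), hvz.isDistribDiv_zero hvL, hvz,
    hvz.mem_solenoidalSpace hvL, locallyIntegrableOn_of_memLp_top (hlin β), fun ψ => ?_⟩
  · refine memLp_top_of_bound (measurable_indexDensity hum).aestronglyMeasurable 3
      (ae_of_all _ fun x => ?_)
    rw [Real.norm_of_nonneg (zero_le_one.trans (one_le_indexDensity u x))]
    exact indexDensity_le u x
  · have h := (hzero β).integral_fderiv_eq_zero ψ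
    simp only [hk1, one_smul, map_sub] at h
    rw [integral_sub (integrable_fderiv_testFunction_apply (hlin β) ψ)
      (integrable_fderiv_testFunction_apply hwm ψ), hwdiv.2 ψ] at h
    linarith
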